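/- Let $N\ge 2$, let $S^{N-1}(\sqrt N)=\{v\in\mathbb R^N:\sum_j v_j^2=N\}$, and let $\sigma^{(N)}$ be the uniform probability measure on it. For $i<j$ and $\theta\in[-\pi,\pi]$ let $R_{i,j,\theta}v$ be the vector obtained from $v$ by replacing $(v_i,v_j)$ with $(v_i\cos\theta-v_j\sin\theta,\ v_i\sin\theta+v_j\cos\theta)$. For the uniform scattering density $\rho(\theta)=\frac1{2\pi}$ set $$Q_N\phi(v)=\binom N2^{-1}\sum_{i<j}\int_{-\pi}^{\pi}\rho(\theta)\,\phi(R_{i,j,\theta}v)\,d\theta,\qquad \mathcal L_N=N(I-Q_N),$$ acting on the real space $L^2(S^{N-1}(\sqrt N),\sigma^{(N)})$, and let $$\Delta_N=\inf\{\langle F,\mathcal L_NF\rangle:\ F\in L^2(S^{N-1}(\sqrt N),\sigma^{(N)}),\ F\perp 1,\ \|F\|_2=1\}.$$ Then, for every $N\ge 2$, $$\Delta_N=\frac12\,\frac{N+2}{N-1},$$ and the function $$F_{\Delta_N}(v)=\sum_{j=1}^N\Bigl(v_j^4-\frac{3N}{N+2}\Bigr)$$ is a (nonzero) eigenfunction of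 $\mathcal L_N$ with eigenvalue $\Delta_N$. If $N\ge 3$, it is the only one up to a multiplicative constant: every eigenfunction of $\mathcal L_N$ in $L^2(S^{N-1}(\sqrt N),\sigma^{(N)})$ with eigenvalue $\Delta_N$ is almost everywhere equal to a constant multiple of $F_{\Delta_N}$. -/

import Mathlib

open MeasureTheory

noncomputable section

namespace Kac

/-- The state space `S^{N-1}(√N)`: velocity vectors `v ∈ ℝ^N` with `∑ v_j² = N`. -/
abbrev KacSphere (N : ℕ) : Type :=
  Metric.sphere (0 : EuclideanSpace ℝ (Fin N)) (Real.sqrt N)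

/-- Dilation by `√N`, from the unit sphere onto `S^{N-1}(√N)`. -/
def dilate (N : ℕ) (x : Metric.sphere (0 : EuclideanSpace ℝ (Fin N)) 1) : KacSphere N :=
  ⟨Real.sqrt N • (x : EuclideanSpace ℝ (Fin N)), by
    have hx : ‖(x : EuclideanSpace ℝ (Fin N))‖ = 1 := by simp
    rw [mem_sphere_zero_iff_norm, norm_smul, hx, mul_one, Real.norm_eq_abs,
      abs_of_nonneg (Real.sqrt_nonneg _)]⟩

/-- The uniform normalized measure `σ^(N)` on `S^{N-1}(√N)`: the image under dilation of the
surface measure of the unit sphere, divided by its total mass. -/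
def sigma (N : ℕ) : Measure (KacSphere N) :=
  ((volume : Measure (EuclideanSpace ℝ (Fin N))).toSphere Set.univ)⁻¹ •
    ((volume : Measure (EuclideanSpace ℝ (Fin N))).toSphere).map (dilate N)

/-- The vector with `(v_i, v_j)` replaced by
`(cos θ v_i - sin θ v_j, sin θ v_i + cos θ v_j)`, the other entries being unchanged. -/
def collideVec {N : ℕ} (i j : Fin N) (θ : ℝ) (v : EuclideanSpace ℝ (Fin N)) :
    EuclideanSpace ℝ (Fin N) :=
  WithLp.toLp 2 fun k =>
    if k = i then Real.cos θ * v i - Real.sin θ * v j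
    else if k = j then Real.sin θ * v i + Real.cos θ * v j
    else v k

theorem norm_collideVec {N : ℕ} {i j : Fin N} (hij : i ≠ j) (θ : ℝ)
    (v : EuclideanSpace ℝ (Fin N)) : ‖collideVec i j θ v‖ = ‖v‖ := by
  have hj : j ∈ Finset.univ.erase i := by simp [hij.symm]
  rw [EuclideanSpace.norm_eq, EuclideanSpace.norm_eq]
  congr 1
  rw [← Finset.add_sum_erase _ _ (Finset.mem_univ i), ← Finset.add_sum_erase _ _ hj,
    ← Finset.add_sum_erase (a := i) _ (fun k => ‖v k‖ ^ 2) (Finset.mem_univ i),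
    ← Finset.add_sum_erase _ (fun k => ‖v k‖ ^ 2) hj]
  have hrest : ∑ k ∈ (Finset.univ.erase i).erase j, ‖(collideVec i j θ v) k‖ ^ 2
      = ∑ k ∈ (Finset.univ.erase i).erase j, ‖v k‖ ^ 2 := by
    refine Finset.sum_congr rfl fun k hk => ?_
    simp only [Finset.mem_erase, Finset.mem_univ, and_true] at hk
    simp [collideVec, hk.1, hk.2]
  rw [hrest]
  simp only [collideVec, Real.norm_eq_abs, sq_abs, if_true, if_neg hij.symm]
  linear_combination (v i ^ 2 + v j ^ 2) * Real.sin_sq_add_cos_sq θ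

/-- The collision `R_{i,j,θ}` of the particles `i ≠ j`, as a map of `S^{N-1}(√N)`. -/
def collide {N : ℕ} {i j : Fin N} (hij : i ≠ j) (θ : ℝ) (v : KacSphere N) : KacSphere N :=
  ⟨collideVec i j θ v, by
    rw [mem_sphere_zero_iff_norm, norm_collideVec hij]
    exact mem_sphere_zero_iff_norm.mp v.2⟩

/-- `P_{i,j} φ(v) = ∫_{-π}^{π} ρ(θ) φ(R_{i,j,θ} v) dθ`. -/
def pairAverage {N : ℕ} (ρ : ℝ → ℝ) {i j : Fin N} (hij : i ≠ j) (φ : KacSphere N → ℝ)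
    (v : KacSphere N) : ℝ :=
  ∫ θ in (-Real.pi)..Real.pi, ρ θ * φ (collide hij θ v)

/-- The Markov transition operator `Q_N φ = (N choose 2)⁻¹ ∑_{i<j} P_{i,j} φ`. -/
def Q {N : ℕ} (ρ : ℝ → ℝ) (φ : KacSphere N → ℝ) (v : KacSphere N) : ℝ :=
  (1 / (N.choose 2 : ℝ)) *
    ∑ p : {p : Fin N × Fin N // p.1 < p.2}, pairAverage ρ (ne_of_lt p.2) φ v

/-- The generator `L_N = N (I - Q_N)`. -/
def generator {N : ℕ} (ρ : ℝ → ℝ) (φ : KacSphere N → ℝ) (v : KacSphere N) : ℝ :=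
  (N : ℝ) * (φ v - Q ρ φ v)

/-- The inner product `⟨F, G⟩` of `L²(S^{N-1}(√N), σ^(N))`. -/
def innerL2 {N : ℕ} (F G : KacSphere N → ℝ) : ℝ := ∫ v, F v * G v ∂(sigma N)

/-- The gap `Δ_N = inf {⟨F, L_N F⟩ : F ∈ L², F ⊥ 1, ‖F‖₂ = 1}`. -/
def gap (N : ℕ) (ρ : ℝ → ℝ) : ℝ :=
  sInf {r : ℝ | ∃ F : KacSphere N → ℝ, MemLp F 2 (sigma N) ∧
    innerL2 F (fun _ => 1) = 0 ∧ innerL2 F F = 1 ∧ r = innerL2 F (generator ρ F)}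

/-- `F` is an eigenfunction of `L_N` on `L²(S^{N-1}(√N), σ^(N))` with eigenvalue `c`. -/
def IsEigenfunction {N : ℕ} (ρ : ℝ → ℝ) (c : ℝ) (F : KacSphere N → ℝ) : Prop :=
  MemLp F 2 (sigma N) ∧ ¬ (F =ᵐ[sigma N] fun _ => 0) ∧
    generator ρ F =ᵐ[sigma N] fun v => c * F v

/-- The function `∑_j (v_j⁴ - 3N/(N+2))` on `S^{N-1}(√N)`. -/
def gapFunction (N : ℕ) (v : KacSphere N) : ℝ :=
  ∑ j : Fin N, ((v : EuclideanSpace ℝ (Fin N)) j ^ 4 - 3 * (N : ℝ) / ((N : ℝ) + 2))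

end Kac

end

/-! The proof is an induction on the number of particles, carried out algebraically on homogeneous
polynomials and transferred to `L²` of the sphere only at the end. Rotation averages become
orthogonal projections for the Fischer inner product: the infinitesimal rotations `rot i j` are
skew-adjoint for it, and `rotAverage S` projects onto the polynomials that they annihilate for `i, j
∈ S`.

Let `P_S` be this projection and `|S| = m + 1`, `m ≥ 2`. The claim `offDiag_form_ge` bounds the sum
of `‖f - P_{ij} f‖²` over ordered pairs below by a multiple of `‖f‖² - ‖P_S f‖²`. Summing the claim
for all `S \ {k}` counts each pair `|S| - 2` times, so the step needs only an upper bound on `∑_k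
P_{S\{k}}` on the complement of the invariants.

That bound is a one-variable problem. A polynomial invariant under rotations of `S \ {k}` is
uniquely a polynomial in `x_k` over the ring of invariants of `S` (`exists_aeval_X_eq`,
`aeval_X_injective`). If `∑_k P_{S\{k}} f = μ f` and `P_{S\{k}} f = η_k(x_k)`, projecting gives `η_j
+ ∑_{k≠j} K η_k = μ η_j` for a correlation operator `K`, which sends `x^a` to a sphere moment times
`(ω - x²)^{a/2}`. `K` is triangular in the degree, with eigenvalues `(-1)^{a/2} E[x^a]`: none lies
below `-1/m`, and for `a ≠ 0` the largest is `3/(m(m+2))`, reached only at `a = 4`. If `μ - 1 >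
1/m`, the lower bound forces all `η_j` to agree; the upper bound then gives `μ - 1 ≤ 3/(m+2)`, and
equality forces a quartic.

To return to the sphere, `f - P_{ij} f` is a `rot i j`-derivative, hence integrates to zero over a
full turn, so the collision average of a polynomial is its algebraic projection. Invariants restrict
to constants, and polynomials are dense in `L²`. Thus the eigenpolynomials of the pair averages span
a dense space of eigenvectors of the symmetric operator `Q`, which determines the gap and, for `N ≥
3`, its eigenspace. -/

namespace Kac

open MvPolynomial

/-! ### Infinitesimal rotations and the structure of their invariants -/

section Rotation

variable {σ : Type*}

/-- The infinitesimal rotation `X i ∂_j - X j ∂_i` acting on polynomials. -/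
noncomputable def rot (i j : σ) : Derivation ℝ (MvPolynomial σ ℝ) (MvPolynomial σ ℝ) :=
  (X i : MvPolynomial σ ℝ) • pderiv j - (X j : MvPolynomial σ ℝ) • pderiv i

theorem rot_apply (i j : σ) (f : MvPolynomial σ ℝ) :
    rot i j f = X i * pderiv j f - X j * pderiv i f := by
  simp [rot]

theorem rot_self (i : σ) (f : MvPolynomial σ ℝ) : rot i i f = 0 := by
  simp [rot_apply]

theorem rot_swap (i j : σ) (f : MvPolynomial σ ℝ) : rot i j f = -rot j i f := by
  simp [rot_apply]

theorem rot_mul (i j : σ) (f g : MvPolynomial σ ℝ) :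
    rot i j (f * g) = f * rot i j g + g * rot i j f := by
  simp [Derivation.leibniz]

theorem rot_X [DecidableEq σ] (i j k : σ) :
    rot i j (X k : MvPolynomial σ ℝ) =
      (if k = j then X i else 0) - (if k = i then X j else 0) := by
  rw [rot_apply, pderiv_X, pderiv_X]
  simp only [Pi.single_apply]
  split_ifs <;> simp

theorem pderiv_comm (i j : σ) (f : MvPolynomial σ ℝ) :
    pderiv i (pderiv j f) = pderiv j (pderiv i f) := by
  classical
  have h : ⁅pderiv (R := ℝ) i, pderiv j⁆ = (0 : Derivation ℝ (MvPolynomial σ ℝ) (MvPolynomial σ ℝ)) := by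
    refine MvPolynomial.derivation_ext fun k => ?_
    rw [Derivation.commutator_apply, pderiv_X, pderiv_X]
    simp only [Pi.single_apply]
    split_ifs <;> simp
  have := DFunLike.congr_fun h f
  rwa [Derivation.commutator_apply, Derivation.zero_apply, sub_eq_zero] at this

theorem rot_pderiv [DecidableEq σ] (i j l : σ) (f : MvPolynomial σ ℝ) :
    rot i j (pderiv l f) = pderiv l (rot i j f) -
      (if l = i then pderiv j f else 0) + (if l = j then pderiv i f else 0) := by
  rw [rot_apply, rot_apply, map_sub, pderiv_mul, pderiv_mul, pderiv_X, pderiv_X,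
    pderiv_comm j l, pderiv_comm i l]
  simp only [Pi.single_apply, eq_comm (b := l)]
  split_ifs <;> ring

/-- The polynomials invariant under the rotations of the coordinates in `S`. -/
noncomputable def rotInvariants (S : Finset σ) : Subalgebra ℝ (MvPolynomial σ ℝ) where
  carrier := {f | ∀ i ∈ S, ∀ j ∈ S, rot i j f = 0}
  mul_mem' hf hg i hi j hj := by rw [rot_mul, hf i hi j hj, hg i hi j hj]; simp
  add_mem' hf hg i hi j hj := by rw [map_add, hf i hi j hj, hg i hi j hj]; simp
  algebraMap_mem' r i _ j _ := by simp

theorem rotInvariants_anti {S T : Finset σ} (h : S ⊆ T) : rotInvariants T ≤ rotInvariants S :=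
  fun _ hf i hi j hj => hf i (h hi) j (h hj)

/-- The squared norm of the coordinates in `S`, as a polynomial. -/
noncomputable def normSqOn (S : Finset σ) : MvPolynomial σ ℝ := ∑ i ∈ S, X i ^ 2

theorem normSqOn_mem_rotInvariants (S : Finset σ) : normSqOn S ∈ rotInvariants S := by
  classical
  intro i hi j hj
  have h : ∀ k, rot i j (X k ^ 2 : MvPolynomial σ ℝ) =
      (if k = j then 2 * X k * X i else 0) - (if k = i then 2 * X k * X j else 0) := by
    intro k
    rw [pow_two, rot_mul, rot_X]
    split_ifs <;> ring
  rw [normSqOn, map_sum, Finset.sum_congr rfl fun k _ => h k, Finset.sum_sub_distrib,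
    Finset.sum_ite_eq', Finset.sum_ite_eq', if_pos hi, if_pos hj]
  ring

theorem normSqOn_erase [DecidableEq σ] {S : Finset σ} {j : σ} (hj : j ∈ S) :
    normSqOn (S.erase j) = normSqOn S - X j ^ 2 := by
  rw [normSqOn, normSqOn, ← Finset.add_sum_erase S _ hj]
  ring

theorem X_mem_rotInvariants_erase [DecidableEq σ] (S : Finset σ) (k : σ) :
    (X k : MvPolynomial σ ℝ) ∈ rotInvariants (S.erase k) := by
  intro i hi j hj
  rw [rot_X, if_neg (Finset.ne_of_mem_erase hj).symm, if_neg (Finset.ne_of_mem_erase hi).symm,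
    sub_zero]

theorem totalDegree_pderiv_add_one_le (i : σ) (f : MvPolynomial σ ℝ) (h : pderiv i f ≠ 0) :
    (pderiv i f).totalDegree + 1 ≤ f.totalDegree := by
  classical
  rw [Nat.add_one_le_iff, totalDegree, Finset.sup_lt_iff]
  · intro m hm
    rw [mem_support_iff, coeff_pderiv] at hm
    have hs : m + Finsupp.single i 1 ∈ f.support := by
      rw [mem_support_iff]; exact left_ne_zero_of_mul hm
    have := le_totalDegree hs
    rw [Finsupp.sum_add_index' (by simp) (by simp), Finsupp.sum_single_index rfl] at this
    omega
  · rw [bot_eq_zero, Nat.pos_iff_ne_zero]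
    intro h0
    apply h
    rw [totalDegree_eq_zero_iff_eq_C.mp h0, pderiv_C]

theorem totalDegree_rot_le (i j : σ) (f : MvPolynomial σ ℝ) :
    (rot i j f).totalDegree ≤ f.totalDegree := by
  have h : ∀ i j : σ, (X i * pderiv j f : MvPolynomial σ ℝ).totalDegree ≤ f.totalDegree := by
    intro i j
    by_cases h0 : pderiv j f = 0
    · simp [h0]
    · refine (totalDegree_mul _ _).trans ?_
      rw [totalDegree_X, add_comm]
      exact totalDegree_pderiv_add_one_le j f h0
  rw [rot_apply]
  exact (totalDegree_sub _ _).trans (max_le (h _ _) (h _ _))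

/-- The gradient of a rotation invariant is radial. From `x_a ∂_b f = x_b ∂_a f` and primality of
`x_a`, the variable `x_a` divides `∂_a f`; the quotient then serves every direction in `T`. Two
coordinates are needed for there to be a relation at all. -/
theorem exists_pderiv_eq_X_mul {T : Finset σ} (hT : 2 ≤ T.card) {f : MvPolynomial σ ℝ}
    (hf : f ∈ rotInvariants T) : ∃ q, ∀ i ∈ T, pderiv i f = X i * q := by
  classical
  have hX : ∀ i ∈ T, ∀ j ∈ T, X i * pderiv j f = X j * pderiv i f := fun i hi j hj => by
    have := hf i hi j hj
    rwa [rot_apply, sub_eq_zero] at this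
  obtain ⟨a, ha, b, hb, hab⟩ := Finset.one_lt_card.mp hT
  have hdvd : (X a : MvPolynomial σ ℝ) ∣ pderiv a f := by
    have h1 : (X a : MvPolynomial σ ℝ) ∣ X b * pderiv a f := ⟨_, (hX a ha b hb).symm⟩
    rcases (X_prime (i := a) (R := ℝ)).dvd_or_dvd h1 with h | h
    · rw [X_dvd_X] at h
      exact absurd h hab
    · exact h
  obtain ⟨q, hq⟩ := hdvd
  refine ⟨q, fun i hi => mul_left_cancel₀ (X_ne_zero (R := ℝ) a) ?_⟩
  rw [hX a ha i hi, hq]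
  ring

theorem rotInvariants_of_X_mul {T : Finset σ} (hT : T.Nonempty) {f q : MvPolynomial σ ℝ}
    (hf : f ∈ rotInvariants T) (hq : ∀ i ∈ T, pderiv i f = X i * q) : q ∈ rotInvariants T := by
  classical
  intro i hi j hj
  obtain ⟨l, hl⟩ := hT
  have h1 := rot_pderiv i j l f
  rw [hf i hi j hj, hq l hl, rot_mul, rot_X, map_zero, hq i hi, hq j hj] at h1
  refine (mul_eq_zero.mp ?_).resolve_left (X_ne_zero (R := ℝ) l)
  split_ifs at h1 <;> linear_combination h1

/-- For polynomials invariant under the rotations of `S.erase k`, the infinitesimal rotations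
involving `k` factor through one operator of degree `-1`. -/
theorem exists_rot_eq_X_mul [DecidableEq σ] {S : Finset σ} {k : σ} (hT : 2 ≤ (S.erase k).card)
    {f : MvPolynomial σ ℝ} (hf : f ∈ rotInvariants (S.erase k)) :
    ∃ g ∈ rotInvariants (S.erase k), ∀ i ∈ S.erase k, rot k i f = X i * g := by
  obtain ⟨q, hq⟩ := exists_pderiv_eq_X_mul hT hf
  have hqT := rotInvariants_of_X_mul (Finset.card_pos.mp (by omega)) hf hq
  refine ⟨X k * q - pderiv k f, sub_mem (mul_mem (X_mem_rotInvariants_erase S k) hqT) ?_, ?_⟩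
  · intro i hi j hj
    rw [rot_pderiv, hf i hi j hj, if_neg (Finset.ne_of_mem_erase hi).symm,
      if_neg (Finset.ne_of_mem_erase hj).symm]
    simp
  · intro i hi
    rw [rot_apply, hq i hi]
    ring

theorem mem_rotInvariants_of_erase [DecidableEq σ] {S : Finset σ} {k : σ}
    {f : MvPolynomial σ ℝ} (hf : f ∈ rotInvariants (S.erase k))
    (h : ∀ i ∈ S.erase k, rot k i f = 0) : f ∈ rotInvariants S := by
  intro i hi j hj
  by_cases hik : i = k
  · subst hik
    by_cases hij : j = i
    · rw [hij, rot_self]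
    · exact h j (Finset.mem_erase.mpr ⟨hij, hj⟩)
  · by_cases hjk : j = k
    · subst hjk
      rw [rot_swap, h i (Finset.mem_erase.mpr ⟨hik, hi⟩), neg_zero]
    · exact hf i (Finset.mem_erase.mpr ⟨hik, hi⟩) j (Finset.mem_erase.mpr ⟨hjk, hj⟩)

/-- The coefficients are killed by `rot k i` and `x_k` goes to `-x_i`, so the chain rule leaves a
derivative in one variable. -/
theorem rot_aeval_X [DecidableEq σ] {S : Finset σ} {i k : σ} (hi : i ∈ S) (hk : k ∈ S)
    (hik : i ≠ k) (h : Polynomial (rotInvariants S)) :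
    rot k i (Polynomial.aeval (X k : MvPolynomial σ ℝ) h) =
      -(X i * Polynomial.aeval (X k : MvPolynomial σ ℝ) h.derivative) := by
  induction h using Polynomial.induction_on' with
  | add p q hp hq => rw [map_add, map_add, hp, hq, Polynomial.derivative_add, map_add]; ring
  | monomial n a =>
    rw [Polynomial.derivative_monomial, Polynomial.aeval_monomial, Polynomial.aeval_monomial,
      rot_mul, Derivation.leibniz_pow, rot_X, if_neg hik.symm, if_pos rfl]
    have ha : rot k i (algebraMap (rotInvariants S) (MvPolynomial σ ℝ) a) = 0 :=
      a.2 k hk i hi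
    rw [ha, map_mul, map_natCast, nsmul_eq_mul, smul_eq_mul]
    ring

/-- The variable `x_k` is transcendental over the invariants: rotating a relation `h(x_k) = 0` gives
`h'(x_k) = 0`, so the degree descends until `h` is constant. -/
theorem aeval_X_injective [DecidableEq σ] {S : Finset σ} {k : σ} (hk : k ∈ S) (hS : 2 ≤ S.card) :
    Function.Injective (Polynomial.aeval (R := rotInvariants S) (X k : MvPolynomial σ ℝ)) := by
  obtain ⟨i, hi, hik⟩ := Finset.exists_mem_ne hS k
  rw [injective_iff_map_eq_zero]
  suffices H : ∀ n : ℕ, ∀ h : Polynomial (rotInvariants S), h.natDegree ≤ n →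
      Polynomial.aeval (X k : MvPolynomial σ ℝ) h = 0 → h = 0 from fun h => H _ h le_rfl
  intro n
  induction n with
  | zero =>
    intro h hn h0
    rw [Polynomial.eq_C_of_natDegree_le_zero hn, Polynomial.aeval_C] at h0
    rw [Polynomial.eq_C_of_natDegree_le_zero hn]
    have : h.coeff 0 = 0 := Subtype.ext h0
    rw [this, Polynomial.C_0]
  | succ n ih =>
    intro h hn h0
    have h1 := rot_aeval_X hi hk hik h
    rw [h0, map_zero, eq_comm, neg_eq_zero, mul_eq_zero] at h1
    have h2 := ih _ ((Polynomial.natDegree_derivative_le h).trans (by omega))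
      (h1.resolve_left (X_ne_zero i))
    have h3 : h.natDegree = 0 := Polynomial.derivative_eq_zero.mp h2
    rw [Polynomial.eq_C_of_natDegree_le_zero h3.le, Polynomial.aeval_C] at h0
    rw [Polynomial.eq_C_of_natDegree_le_zero h3.le]
    have : h.coeff 0 = 0 := Subtype.ext h0
    rw [this, Polynomial.C_0]

theorem aeval_X_mem_rotInvariants_erase [DecidableEq σ] (S : Finset σ) (k : σ)
    (P : Polynomial (rotInvariants S)) :
    Polynomial.aeval (X k : MvPolynomial σ ℝ) P ∈ rotInvariants (S.erase k) := by
  rw [Polynomial.aeval_eq_sum_range]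
  refine sum_mem fun m _ => ?_
  rw [Algebra.smul_def]
  exact mul_mem (rotInvariants_anti (Finset.erase_subset _ _) (P.coeff m).2)
    (pow_mem (X_mem_rotInvariants_erase S k) m)

theorem exists_polynomial_derivative_eq {R : Type*} [CommRing R] [Algebra ℝ R]
    (h : Polynomial R) : ∃ g : Polynomial R, g.derivative = h := by
  induction h using Polynomial.induction_on' with
  | add p q hp hq =>
    obtain ⟨g, rfl⟩ := hp
    obtain ⟨g', rfl⟩ := hq
    exact ⟨g + g', Polynomial.derivative_add⟩
  | monomial n a =>
    refine ⟨Polynomial.monomial (n + 1) (((n + 1 : ℝ)⁻¹) • a), ?_⟩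
    rw [Polynomial.derivative_monomial, Nat.add_sub_cancel]
    congr 1
    have : ((n + 1 : ℕ) : R) = algebraMap ℝ R (n + 1) := by simp
    rw [this, mul_comm, ← Algebra.smul_def, smul_smul, mul_inv_cancel₀ (by positivity), one_smul]

/-- Induction on the degree by solving a differential equation: `rot k i f = x_i g` with `g` of
smaller degree, hence `g = p(x_k)`. An antiderivative `P` of `p` makes `f + P(x_k)` invariant under
all of `S`. -/
theorem exists_aeval_X_eq [DecidableEq σ] {S : Finset σ} {k : σ} (hk : k ∈ S)
    (hT : 2 ≤ (S.erase k).card) {f : MvPolynomial σ ℝ} (hf : f ∈ rotInvariants (S.erase k)) :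
    ∃ h : Polynomial (rotInvariants S), Polynomial.aeval (X k : MvPolynomial σ ℝ) h = f := by
  suffices H : ∀ n : ℕ, ∀ f ∈ rotInvariants (S.erase k), f.totalDegree < n →
      ∃ h : Polynomial (rotInvariants S), Polynomial.aeval (X k : MvPolynomial σ ℝ) h = f from
    H _ f hf (Nat.lt_succ_self _)
  intro n
  induction n with
  | zero => intro f _ h; omega
  | succ n ih =>
    intro f hf hn
    obtain ⟨g, hg, hgf⟩ := exists_rot_eq_X_mul hT hf
    obtain ⟨p, hp⟩ : ∃ p : Polynomial (rotInvariants S),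
        Polynomial.aeval (X k : MvPolynomial σ ℝ) p = g := by
      by_cases h0 : g = 0
      · exact ⟨0, by rw [h0, map_zero]⟩
      · refine ih g hg ?_
        obtain ⟨i, hi⟩ : (S.erase k).Nonempty := Finset.card_pos.mp (by omega)
        have h1 := totalDegree_rot_le k i f
        -- Rotations do not raise the degree, so the factor `x_i` makes `g` strictly smaller than
        -- `f`.
        rw [hgf i hi, totalDegree_mul_of_isDomain (X_ne_zero i) h0, totalDegree_X] at h1
        omega
    obtain ⟨P, hP⟩ := exists_polynomial_derivative_eq p
    have hPT := aeval_X_mem_rotInvariants_erase S k P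
    have hc : f + Polynomial.aeval (X k : MvPolynomial σ ℝ) P ∈ rotInvariants S := by
      refine mem_rotInvariants_of_erase (add_mem hf hPT) fun i hi => ?_
      rw [map_add, hgf i hi, rot_aeval_X (Finset.mem_of_mem_erase hi) hk
        (Finset.ne_of_mem_erase hi), hP, hp]
      ring
    refine ⟨Polynomial.C ⟨_, hc⟩ - P, ?_⟩
    refine (map_sub (Polynomial.aeval (R := rotInvariants S) (X k : MvPolynomial σ ℝ)) _ P).trans ?_
    rw [Polynomial.aeval_C]
    exact add_sub_cancel_right f _

end Rotation

end Kac

namespace Kac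

open MvPolynomial

/-! ### Homogeneous polynomials -/

section Homogeneous

variable {σ : Type*}

theorem rot_isHomogeneous (i j : σ) {d : ℕ} {f : MvPolynomial σ ℝ} (hf : f.IsHomogeneous d) :
    (rot i j f).IsHomogeneous d := by
  have h : ∀ i j : σ, (X i * pderiv j f : MvPolynomial σ ℝ).IsHomogeneous d := by
    intro i j
    rcases Nat.eq_zero_or_pos d with rfl | hd
    · rw [totalDegree_eq_zero_iff_eq_C.mp (Nat.le_zero.mp hf.totalDegree_le), pderiv_C, mul_zero]
      exact isHomogeneous_zero _ _ _
    · have := (isHomogeneous_X ℝ i).mul (hf.pderiv (i := j))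
      rwa [show 1 + (d - 1) = d by omega] at this
  rw [rot_apply]
  exact (h i j).sub (h j i)

theorem homogeneousComponent_rot (i j : σ) (d : ℕ) (f : MvPolynomial σ ℝ) :
    homogeneousComponent d (rot i j f) = rot i j (homogeneousComponent d f) := by
  have h : ∀ n, homogeneousComponent d (rot i j (homogeneousComponent n f)) =
      rot i j (homogeneousComponent d (homogeneousComponent n f)) := by
    intro n
    have h1 := homogeneousComponent_isHomogeneous n f
    rw [homogeneousComponent_of_mem (m := d) h1,
      homogeneousComponent_of_mem (m := d) (rot_isHomogeneous i j h1)]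
    split_ifs <;> simp
  conv_lhs => rw [← sum_homogeneousComponent f]
  conv_rhs => rw [← sum_homogeneousComponent f]
  simp only [map_sum, h]

theorem homogeneousComponent_mem_rotInvariants {S : Finset σ} {f : MvPolynomial σ ℝ}
    (hf : f ∈ rotInvariants S) (d : ℕ) : homogeneousComponent d f ∈ rotInvariants S := by
  intro i hi j hj
  rw [← homogeneousComponent_rot, hf i hi j hj, map_zero]

/-- The space of homogeneous polynomials of degree `d`. -/
def HomPoly (σ : Type*) (d : ℕ) : Type _ := ↥(homogeneousSubmodule σ ℝ d)

noncomputable instance (d : ℕ) : AddCommGroup (HomPoly σ d) :=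
  inferInstanceAs (AddCommGroup ↥(homogeneousSubmodule σ ℝ d))

noncomputable instance (d : ℕ) : Module ℝ (HomPoly σ d) :=
  inferInstanceAs (Module ℝ ↥(homogeneousSubmodule σ ℝ d))

/-- The inclusion of the homogeneous polynomials into all polynomials. -/
noncomputable def toPoly {d : ℕ} : HomPoly σ d →ₗ[ℝ] MvPolynomial σ ℝ :=
  (homogeneousSubmodule σ ℝ d).subtype

theorem toPoly_injective {d : ℕ} : Function.Injective (toPoly (σ := σ) (d := d)) :=
  Subtype.val_injective

theorem toPoly_isHomogeneous {d : ℕ} (f : HomPoly σ d) : (toPoly f).IsHomogeneous d := f.2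

theorem exists_toPoly_eq {d : ℕ} {f : MvPolynomial σ ℝ} (hf : f.IsHomogeneous d) :
    ∃ g : HomPoly σ d, toPoly g = f := ⟨⟨f, hf⟩, rfl⟩

/-- The homogeneous polynomials invariant under the rotations of the coordinates in `S`. -/
noncomputable def homInvariants (S : Finset σ) (d : ℕ) : Submodule ℝ (HomPoly σ d) :=
  (Subalgebra.toSubmodule (rotInvariants S)).comap toPoly

theorem mem_homInvariants {S : Finset σ} {d : ℕ} {f : HomPoly σ d} :
    f ∈ homInvariants S d ↔ toPoly f ∈ rotInvariants S := Iff.rfl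

end Homogeneous

/-! ### The Fischer inner product and projections onto invariants -/

section Fischer

variable {σ : Type*} [Fintype σ]

/-- The Fischer inner product, for which monomials are orthogonal and `‖x^α‖² = α!`. -/
noncomputable def fischer : MvPolynomial σ ℝ →ₗ[ℝ] MvPolynomial σ ℝ →ₗ[ℝ] ℝ :=
  (basisMonomials σ ℝ).constr ℝ fun α => (∏ i, ((α i).factorial : ℝ)) • lcoeff ℝ α

theorem fischer_monomial (α : σ →₀ ℕ) (a : ℝ) (g : MvPolynomial σ ℝ) :
    fischer (monomial α a) g = a * ((∏ i, ((α i).factorial : ℝ)) * coeff α g) := by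
  have h : (monomial α a : MvPolynomial σ ℝ) = a • basisMonomials σ ℝ α := by
    rw [coe_basisMonomials, smul_monomial, smul_eq_mul, mul_one]
  rw [h, map_smul, fischer, Module.Basis.constr_basis]
  simp

theorem fischer_apply (f g : MvPolynomial σ ℝ) :
    fischer f g =
      ∑ α ∈ f.support, coeff α f * ((∏ i, ((α i).factorial : ℝ)) * coeff α g) := by
  conv_lhs => rw [← support_sum_monomial_coeff f]
  rw [map_sum, LinearMap.sum_apply]
  simp only [fischer_monomial]

theorem fischer_comm (f g : MvPolynomial σ ℝ) : fischer f g = fischer g f := by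
  classical
  induction f using MvPolynomial.induction_on' with
  | add p q hp hq => rw [map_add, map_add, LinearMap.add_apply, hp, hq]
  | monomial α a =>
    induction g using MvPolynomial.induction_on' with
    | add p q hp hq => rw [map_add, map_add, LinearMap.add_apply, hp, hq]
    | monomial β b =>
      rw [fischer_monomial, fischer_monomial, coeff_monomial, coeff_monomial]
      by_cases h : α = β
      · subst h; simp; ring
      · rw [if_neg h, if_neg (Ne.symm h)]; simp

/-- The factorial weights are chosen so that multiplication by `x_i` and `∂_i` are adjoint;
skew-adjointness of the rotations follows. -/
theorem fischer_X_mul (i : σ) (f g : MvPolynomial σ ℝ) :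
    fischer (X i * f) g = fischer f (pderiv i g) := by
  classical
  induction f using MvPolynomial.induction_on' with
  | add p q hp hq => rw [mul_add, map_add, map_add, LinearMap.add_apply, LinearMap.add_apply, hp, hq]
  | monomial α a =>
    rw [X, monomial_mul, one_mul, add_comm, fischer_monomial, fischer_monomial, coeff_pderiv,
      ← Finset.mul_prod_erase _ _ (Finset.mem_univ i),
      ← Finset.mul_prod_erase _ (fun j => ((α j).factorial : ℝ)) (Finset.mem_univ i)]
    have h : ∏ j ∈ Finset.univ.erase i, (((α + Finsupp.single i 1 : σ →₀ ℕ) j).factorial : ℝ) =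
        ∏ j ∈ Finset.univ.erase i, ((α j).factorial : ℝ) := by
      refine Finset.prod_congr rfl fun j hj => ?_
      rw [Finsupp.add_apply, Finsupp.single_eq_of_ne (Finset.ne_of_mem_erase hj), add_zero]
    rw [h, Finsupp.add_apply, Finsupp.single_eq_same, Nat.factorial_succ]
    push_cast
    ring

theorem fischer_rot (i j : σ) (f g : MvPolynomial σ ℝ) :
    fischer (rot i j f) g = -fischer f (rot i j g) := by
  rw [rot_apply, rot_apply, map_sub, map_sub, LinearMap.sub_apply, fischer_X_mul, fischer_X_mul,
    fischer_comm (pderiv j f), fischer_comm (pderiv i f), ← fischer_X_mul, ← fischer_X_mul,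
    fischer_comm f, fischer_comm f]
  ring

theorem fischer_self_nonneg (f : MvPolynomial σ ℝ) : 0 ≤ fischer f f := by
  rw [fischer_apply]
  refine Finset.sum_nonneg fun α _ => ?_
  have : 0 ≤ (∏ i, ((α i).factorial : ℝ)) := by positivity
  nlinarith [mul_nonneg this (mul_self_nonneg (coeff α f))]

theorem fischer_self_eq_zero {f : MvPolynomial σ ℝ} (h : fischer f f = 0) : f = 0 := by
  rw [fischer_apply, Finset.sum_eq_zero_iff_of_nonneg] at h
  · ext α
    rw [coeff_zero]
    by_contra hα
    have h1 := h α (mem_support_iff.mpr hα)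
    have : (∏ i, ((α i).factorial : ℝ)) ≠ 0 := by positivity
    simp_all
  · intro α _
    have : 0 ≤ (∏ i, ((α i).factorial : ℝ)) := by positivity
    nlinarith [mul_nonneg this (mul_self_nonneg (coeff α f))]

theorem fischer_homogeneousComponent {d : ℕ} {f : MvPolynomial σ ℝ} (hf : f.IsHomogeneous d)
    (g : MvPolynomial σ ℝ) : fischer f (homogeneousComponent d g) = fischer f g := by
  rw [fischer_apply, fischer_apply]
  refine Finset.sum_congr rfl fun α hα => ?_
  rw [coeff_homogeneousComponent, if_pos]
  rw [mem_support_iff] at hα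
  by_contra h
  exact hα (hf.coeff_eq_zero h)

instance (d : ℕ) : FiniteDimensional ℝ (HomPoly σ d) :=
  Submodule.finiteDimensional_of_le (S₁ := homogeneousSubmodule σ ℝ d)
    (S₂ := restrictTotalDegree σ ℝ d) fun f hf => by
    rw [mem_restrictTotalDegree]
    exact IsHomogeneous.totalDegree_le hf

/-- The Fischer inner product on homogeneous polynomials. -/
@[reducible]
noncomputable def fischerCore (σ : Type*) [Fintype σ] (d : ℕ) :
    InnerProductSpace.Core ℝ (HomPoly σ d) where
  inner f g := fischer (toPoly f) (toPoly g)
  conj_inner_symm f g := fischer_comm _ _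
  re_inner_nonneg f := fischer_self_nonneg _
  add_left f g h := by simp
  smul_left f g r := by simp
  definite f h := toPoly_injective ((fischer_self_eq_zero h).trans (map_zero _).symm)

noncomputable instance (d : ℕ) : NormedAddCommGroup (HomPoly σ d) :=
  (fischerCore σ d).toNormedAddCommGroup

noncomputable instance (d : ℕ) : InnerProductSpace ℝ (HomPoly σ d) :=
  InnerProductSpace.ofCore (fischerCore σ d).toCore

theorem homPoly_inner {d : ℕ} (f g : HomPoly σ d) :
    inner ℝ f g = fischer (toPoly f) (toPoly g) := rfl

/-- The orthogonal projection onto the polynomials invariant under the rotations in `S`. -/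
noncomputable def rotAverage (S : Finset σ) (d : ℕ) : HomPoly σ d →ₗ[ℝ] HomPoly σ d :=
  (homInvariants S d).starProjection.toLinearMap

theorem rotAverage_mem (S : Finset σ) {d : ℕ} (f : HomPoly σ d) :
    toPoly (rotAverage S d f) ∈ rotInvariants S :=
  Submodule.starProjection_apply_mem (homInvariants S d) f

theorem rotAverage_eq_self {S : Finset σ} {d : ℕ} {f : HomPoly σ d}
    (hf : toPoly f ∈ rotInvariants S) : rotAverage S d f = f :=
  Submodule.starProjection_eq_self_iff.mpr (mem_homInvariants.mpr hf)

theorem rotAverage_isSymmetric (S : Finset σ) (d : ℕ) : (rotAverage S d).IsSymmetric :=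
  Submodule.starProjection_isSymmetric _

theorem inner_rotAverage (S : Finset σ) {d : ℕ} (f : HomPoly σ d) :
    inner ℝ (rotAverage S d f) f = ‖rotAverage S d f‖ ^ 2 := by
  have h := rotAverage_isSymmetric S d f (rotAverage S d f)
  rw [rotAverage_eq_self (rotAverage_mem S f)] at h
  rw [← real_inner_self_eq_norm_sq, real_inner_comm, ← h]

theorem norm_sub_rotAverage_sq (S : Finset σ) {d : ℕ} (f : HomPoly σ d) :
    ‖f - rotAverage S d f‖ ^ 2 = ‖f‖ ^ 2 - ‖rotAverage S d f‖ ^ 2 := by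
  rw [norm_sub_sq_real, real_inner_comm, inner_rotAverage]
  ring

theorem inner_sub_rotAverage {S : Finset σ} {d : ℕ} (f : HomPoly σ d) {g : HomPoly σ d}
    (hg : toPoly g ∈ rotInvariants S) : inner ℝ (f - rotAverage S d f) g = 0 :=
  Submodule.starProjection_inner_eq_zero (K := homInvariants S d) f g hg

theorem fischer_sub_rotAverage {S : Finset σ} {d : ℕ} (f : HomPoly σ d) {g : MvPolynomial σ ℝ}
    (hg : g ∈ rotInvariants S) : fischer (toPoly f - toPoly (rotAverage S d f)) g = 0 := by
  obtain ⟨p, hp⟩ := exists_toPoly_eq (homogeneousComponent_isHomogeneous d g)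
  rw [← map_sub, ← fischer_homogeneousComponent (toPoly_isHomogeneous _), ← hp, ← homPoly_inner]
  refine inner_sub_rotAverage f ?_
  rw [hp]
  exact homogeneousComponent_mem_rotInvariants hg d

/-- Recognises a projection without knowing beforehand that the candidate is homogeneous: its
difference from the true projection is invariant and orthogonal to all invariants, itself included.
-/
theorem rotAverage_eq_of_fischer {S : Finset σ} {d : ℕ} {f : HomPoly σ d} {g : MvPolynomial σ ℝ}
    (hg : g ∈ rotInvariants S)
    (h : ∀ p ∈ rotInvariants S, fischer (toPoly f - g) p = 0) :
    toPoly (rotAverage S d f) = g := by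
  have hd : toPoly (rotAverage S d f) - g ∈ rotInvariants S :=
    sub_mem (rotAverage_mem S f) hg
  refine sub_eq_zero.mp (fischer_self_eq_zero ?_)
  have h1 := h _ hd
  have h2 := fischer_sub_rotAverage f hd
  rw [map_sub fischer, LinearMap.sub_apply] at h1 h2 ⊢
  linarith

theorem rotAverage_eq_zero {S : Finset σ} {d : ℕ} {f : HomPoly σ d}
    (h : ∀ g : HomPoly σ d, toPoly g ∈ rotInvariants S → inner ℝ f g = 0) :
    rotAverage S d f = 0 := by
  have h1 := inner_rotAverage S f
  rw [real_inner_comm, h _ (rotAverage_mem S f)] at h1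
  exact norm_eq_zero.mp (pow_eq_zero_iff two_ne_zero |>.mp h1.symm)

end Fischer

end Kac

namespace Kac

/-! ### Moments of the sphere and the eigenvalues of the correlation operator -/

section KacCoeff

/-- The moments `E[x₁^a]` of the uniform distribution on the unit sphere of `ℝ^m`. -/
noncomputable def sphereMoment (m : ℕ) : ℕ → ℝ
  | 0 => 1
  | 1 => 0
  | a + 2 => (a + 1) / (m + a) * sphereMoment m a

theorem sphereMoment_add_two (m a : ℕ) :
    sphereMoment m (a + 2) = (a + 1) / (m + a) * sphereMoment m a := rfl

theorem sphereMoment_odd (m b : ℕ) : sphereMoment m (2 * b + 1) = 0 := by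
  induction b with
  | zero => rfl
  | succ b ih => rw [show 2 * (b + 1) + 1 = (2 * b + 1) + 2 by ring, sphereMoment_add_two, ih,
      mul_zero]

theorem sphereMoment_even_nonneg (m b : ℕ) : 0 ≤ sphereMoment m (2 * b) := by
  induction b with
  | zero => exact zero_le_one
  | succ b ih =>
    rw [show 2 * (b + 1) = 2 * b + 2 by ring, sphereMoment_add_two]
    positivity

theorem sphereMoment_even_anti {m : ℕ} (hm : 1 ≤ m) :
    Antitone fun b => sphereMoment m (2 * b) := by
  refine antitone_nat_of_succ_le fun b => ?_
  rw [show 2 * (b + 1) = 2 * b + 2 by ring, sphereMoment_add_two]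
  refine mul_le_of_le_one_left (sphereMoment_even_nonneg m b) ?_
  have : (1 : ℝ) ≤ m := by exact_mod_cast hm
  rw [div_le_one (by positivity)]
  linarith

theorem sphereMoment_two (m : ℕ) : sphereMoment m 2 = 1 / m := by
  rw [sphereMoment_add_two]
  simp [sphereMoment]

theorem sphereMoment_four {m : ℕ} : sphereMoment m 4 = 3 / (m * (m + 2)) := by
  rw [show 4 = 2 + 2 from rfl, sphereMoment_add_two, sphereMoment_two, div_mul_div_comm]
  norm_num
  ring

/-- The leading coefficient of the average of `x_k^a` given `x_j`, as a polynomial in `x_j`. -/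
noncomputable def kacEigenvalue (m a : ℕ) : ℝ := (-1) ^ (a / 2) * sphereMoment m a

/-- Odd moments vanish and even moments decrease, so the worst negative value occurs at `a = 2`,
where it is `-1/m`. -/
theorem neg_inv_le_kacEigenvalue {m : ℕ} (hm : 1 ≤ m) (a : ℕ) : -(1 / m) ≤ kacEigenvalue m a := by
  rw [kacEigenvalue]
  rcases Nat.even_or_odd' a with ⟨b, rfl | rfl⟩
  · rcases Nat.eq_zero_or_pos b with rfl | hb
    · simp only [mul_zero, Nat.zero_div, pow_zero, one_mul, sphereMoment]
      have : (0 : ℝ) ≤ 1 / m := by positivity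
      linarith
    · have h := sphereMoment_even_anti hm (show 1 ≤ b from hb)
      simp only [mul_one, sphereMoment_two] at h
      have h0 := sphereMoment_even_nonneg m b
      rcases neg_one_pow_eq_or ℝ (2 * b / 2) with h1 | h1 <;> rw [h1] <;> linarith
  · rw [sphereMoment_odd, mul_zero, neg_nonpos]
    positivity

/-- The sign is negative at `a = 2` and positive at `a = 4`. From `a = 6` on, absolute values are at
most the sixth moment, which is `5/(m+4) < 1` times the fourth; this strictness is where `m ≥ 2`
enters. -/
theorem kacEigenvalue_le {m : ℕ} (hm : 2 ≤ m) {a : ℕ} (ha : a ≠ 0) :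
    kacEigenvalue m a ≤ 3 / (m * (m + 2)) ∧
      (kacEigenvalue m a = 3 / (m * (m + 2)) → a = 4) := by
  have hm' : (2 : ℝ) ≤ m := by exact_mod_cast hm
  have hpos : (0 : ℝ) < 3 / (m * (m + 2)) := by positivity
  suffices H : a ≠ 4 → kacEigenvalue m a < 3 / (m * (m + 2)) by
    refine ⟨?_, fun h => by_contra fun h4 => (H h4).ne h⟩
    by_cases h4 : a = 4
    · subst h4
      rw [kacEigenvalue, sphereMoment_four]
      norm_num
    · exact (H h4).le
  intro h4
  rw [kacEigenvalue]
  rcases Nat.even_or_odd' a with ⟨b, rfl | rfl⟩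
  · by_cases hb : b = 1
    · subst hb
      have := sphereMoment_even_nonneg m 1
      norm_num at this ⊢
      linarith
    · have h := sphereMoment_even_anti (show 1 ≤ m by omega) (show 3 ≤ b by omega)
      simp only at h
      have h6 : sphereMoment m (2 * 3) < 3 / (m * (m + 2)) := by
        rw [show 2 * 3 = 4 + 2 from rfl, sphereMoment_add_two, sphereMoment_four]
        refine mul_lt_of_lt_one_left hpos ?_
        rw [div_lt_one (by positivity)]
        push_cast
        linarith
      have h0 := sphereMoment_even_nonneg m b
      rcases neg_one_pow_eq_or ℝ (2 * b / 2) with h1 | h1 <;> rw [h1] <;> linarith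
  · rwa [sphereMoment_odd, mul_zero]

end KacCoeff

/-! ### The correlation operator on polynomials in one variable -/

section KacOperator

open Polynomial

variable {R : Type*} [CommRing R] [Algebra ℝ R]

/-- The average of `x_k^a` given `x_j = X`, on the sphere of squared radius `ω`. -/
noncomputable def kacPoly (m : ℕ) (ω : R) (a : ℕ) : R[X] :=
  sphereMoment m a • (C ω - X ^ 2) ^ (a / 2)

/-- The correlation operator: the conditional expectation of `h(x_k)` given `x_j = X`. -/
noncomputable def kacOp (m : ℕ) (ω : R) : R[X] →ₗ[R] R[X] :=
  Polynomial.lsum fun a => LinearMap.toSpanSingleton R R[X] (kacPoly m ω a)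

theorem kacOp_apply (m : ℕ) (ω : R) (s : R[X]) :
    kacOp m ω s = s.sum fun a p => p • kacPoly m ω a := rfl

theorem kacOp_monomial (m : ℕ) (ω : R) (a : ℕ) (p : R) :
    kacOp m ω (monomial a p) = p • kacPoly m ω a := by
  rw [kacOp_apply]
  exact sum_monomial_index p _ (zero_smul R _)

theorem kacOp_real_smul (m : ℕ) (ω : R) (r : ℝ) (s : R[X]) :
    kacOp m ω (r • s) = r • kacOp m ω s := by
  rw [← algebraMap_smul R r s, map_smul, algebraMap_smul]

theorem coeff_kacPoly_odd (m : ℕ) (ω : R) (a b : ℕ) : (kacPoly m ω a).coeff (2 * b + 1) = 0 := by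
  rw [kacPoly, coeff_smul, show ((C ω - X ^ 2) ^ (a / 2) : R[X]) = expand R 2 ((C ω - X) ^ (a / 2)) by simp, coeff_expand two_pos, if_neg (by omega), smul_zero]

theorem coeff_kacPoly_of_le (m : ℕ) (ω : R) {a n : ℕ} (h : a ≤ n) :
    (kacPoly m ω a).coeff n = if a = n then algebraMap ℝ R (kacEigenvalue m a) else 0 := by
  have hdeg : natDegree ((C ω - X) ^ (a / 2) : R[X]) ≤ a / 2 := by
    refine (natDegree_pow_le).trans ?_
    have : natDegree (C ω - X : R[X]) ≤ 1 :=
      (natDegree_sub_le _ _).trans (by simp [natDegree_X_le])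
    exact (Nat.mul_le_mul_left _ this).trans (mul_one _).le
  rcases Nat.even_or_odd' n with ⟨b, rfl | rfl⟩
  · rw [kacPoly, coeff_smul, show ((C ω - X ^ 2) ^ (a / 2) : R[X]) = expand R 2 ((C ω - X) ^ (a / 2)) by simp, mul_comm 2 b, coeff_expand_mul two_pos]
    split_ifs with hab
    · subst hab
      rw [Nat.mul_div_cancel _ two_pos, kacEigenvalue, Nat.mul_div_cancel _ two_pos]
      have : ((C ω - X) ^ b : R[X]).coeff b = (-1) ^ b := by
        have h1 : natDegree (C ω - X : R[X]) ≤ 1 :=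
          (natDegree_sub_le _ _).trans (by simp [natDegree_X_le])
        have := coeff_pow_of_natDegree_le (m := b) h1
        rw [mul_one] at this
        rw [this]
        simp
      rw [this, Algebra.smul_def, map_mul, map_pow, map_neg, map_one, mul_comm]
    · by_cases hb : a / 2 = b
      · have : a = 2 * (a / 2) + 1 ∨ a = 2 * (a / 2) := by omega
        rcases this with h1 | h1
        · rw [h1, sphereMoment_odd, zero_smul]
        · omega
      · rw [coeff_eq_zero_of_natDegree_lt (by omega), smul_zero]
  · rw [coeff_kacPoly_odd]
    split_ifs with hab
    · rw [hab, kacEigenvalue, sphereMoment_odd, mul_zero, map_zero]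
    · rfl

theorem coeff_kacOp_odd (m : ℕ) (ω : R) (s : R[X]) (b : ℕ) :
    (kacOp m ω s).coeff (2 * b + 1) = 0 := by
  rw [kacOp_apply, Polynomial.sum, finsetSum_coeff]
  refine Finset.sum_eq_zero fun a _ => ?_
  rw [coeff_smul, coeff_kacPoly_odd, smul_zero]

theorem coeff_kacOp_natDegree (m : ℕ) (ω : R) (s : R[X]) :
    (kacOp m ω s).coeff s.natDegree = kacEigenvalue m s.natDegree • s.leadingCoeff := by
  rw [kacOp_apply, Polynomial.sum, finsetSum_coeff]
  have h : ∀ a ∈ s.support, (s.coeff a • kacPoly m ω a).coeff s.natDegree =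
      if a = s.natDegree then s.coeff a • algebraMap ℝ R (kacEigenvalue m a) else 0 := by
    intro a ha
    rw [coeff_smul, coeff_kacPoly_of_le m ω (le_natDegree_of_mem_supp a ha)]
    split_ifs <;> simp
  rw [Finset.sum_congr rfl h, Finset.sum_ite_eq']
  split_ifs with hs
  · rw [smul_eq_mul, mul_comm, Algebra.smul_def, leadingCoeff]
  · rw [notMem_support_iff] at hs
    rw [leadingCoeff, hs, smul_zero]

/-- The operator is triangular in the degree, so comparing leading coefficients determines the
eigenvalue; the lower-order terms and `ω` play no role. -/
theorem eq_kacEigenvalue [IsDomain R] {m : ℕ} {ω : R} {κ : ℝ} {s : R[X]} (hs : s ≠ 0)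
    (h : kacOp m ω s = κ • s) : κ = kacEigenvalue m s.natDegree := by
  have h1 := coeff_kacOp_natDegree m ω s
  rw [h, coeff_smul, coeff_natDegree, ← sub_eq_zero, ← sub_smul, Algebra.smul_def, mul_eq_zero] at h1
  have h2 := h1.resolve_right (leadingCoeff_ne_zero.mpr hs)
  rw [map_eq_zero_iff _ (algebraMap ℝ R).injective] at h2
  linarith

end KacOperator

/-! ### The projection of a polynomial in one coordinate -/

section Average

open MvPolynomial

variable {σ : Type*} [DecidableEq σ]

/-- The squared norm of the coordinates in `S`, as an element of the ring of invariants. -/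
noncomputable def invNormSq (S : Finset σ) : rotInvariants S :=
  ⟨normSqOn S, normSqOn_mem_rotInvariants S⟩

theorem aeval_kacPoly {S : Finset σ} {j : σ} (hj : j ∈ S) (m a : ℕ) :
    Polynomial.aeval (X j : MvPolynomial σ ℝ) (kacPoly m (invNormSq S) a) =
      sphereMoment m a • normSqOn (S.erase j) ^ (a / 2) := by
  rw [kacPoly, ← algebraMap_smul (rotInvariants S), map_smul, algebraMap_smul, map_pow, map_sub,
    map_pow, Polynomial.aeval_C, Polynomial.aeval_X, normSqOn_erase hj]
  rfl

variable [Fintype σ]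

/-- Integration by parts: images of rotations are orthogonal to invariants. Summing `rot i k (p
x_k^{a+1} x_i)` over `i ≠ k` in `T` yields the recursion of the sphere moments. -/
theorem fischer_mul_X_pow_add_two {T : Finset σ} {k : σ} (hk : k ∈ T) {p g : MvPolynomial σ ℝ}
    (hp : p ∈ rotInvariants T) (hg : g ∈ rotInvariants T) (a : ℕ) :
    (T.card + a : ℝ) * fischer (p * X k ^ (a + 2)) g =
      (a + 1) * fischer (p * normSqOn T * X k ^ a) g := by
  have h1 : ∀ i ∈ T.erase k, rot i k (p * X k ^ (a + 1) * X i) =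
      p * ((a + 1 : ℝ) • (X k ^ a * X i ^ 2) - X k ^ (a + 2)) := by
    intro i hi
    have hik := Finset.ne_of_mem_erase hi
    rw [rot_mul, rot_mul, Derivation.leibniz_pow, rot_X, rot_X, hp i (Finset.mem_of_mem_erase hi) k hk,
      if_pos rfl, if_neg hik.symm, if_neg hik, if_pos rfl, smul_eq_C_mul, nsmul_eq_mul,
      Nat.add_sub_cancel]
    simp only [smul_eq_mul, map_add, map_natCast, map_one]
    push_cast
    ring
  have h2 : ∑ i ∈ T.erase k, rot i k (p * X k ^ (a + 1) * X i) =
      (a + 1 : ℝ) • (p * normSqOn T * X k ^ a) - (T.card + a : ℝ) • (p * X k ^ (a + 2)) := by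
    have hc : ((T.erase k).card : MvPolynomial σ ℝ) = (T.card : MvPolynomial σ ℝ) - 1 := by
      rw [Finset.card_erase_of_mem hk, Nat.cast_sub (Finset.card_pos.mpr ⟨k, hk⟩), Nat.cast_one]
    have hn : ∑ i ∈ T.erase k, (X i ^ 2 : MvPolynomial σ ℝ) = normSqOn T - X k ^ 2 :=
      normSqOn_erase hk
    rw [Finset.sum_congr rfl h1, ← Finset.mul_sum, Finset.sum_sub_distrib, ← Finset.smul_sum,
      ← Finset.mul_sum, hn, Finset.sum_const, nsmul_eq_mul, hc]
    simp only [smul_eq_C_mul, map_add, map_natCast, map_one]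
    ring
  have h3 : fischer (∑ i ∈ T.erase k, rot i k (p * X k ^ (a + 1) * X i)) g = 0 := by
    rw [map_sum, LinearMap.sum_apply]
    refine Finset.sum_eq_zero fun i hi => ?_
    rw [fischer_rot, hg i (Finset.mem_of_mem_erase hi) k hk, map_zero, neg_zero]
  rw [h2, map_sub, map_smul, map_smul] at h3
  simp only [LinearMap.sub_apply, LinearMap.smul_apply, smul_eq_mul] at h3
  linarith

theorem fischer_mul_X_pow {T : Finset σ} (hT : 2 ≤ T.card) {k : σ} (hk : k ∈ T)
    {g : MvPolynomial σ ℝ} (hg : g ∈ rotInvariants T) (a : ℕ) :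
    ∀ {p : MvPolynomial σ ℝ}, p ∈ rotInvariants T → fischer (p * X k ^ a) g =
      sphereMoment T.card a * fischer (p * normSqOn T ^ (a / 2)) g := by
  induction a using Nat.twoStepInduction with
  | zero => intro p _; simp [sphereMoment]
  | one =>
    intro p hp
    obtain ⟨i, hi, hik⟩ := Finset.exists_mem_ne hT k
    -- The first moment vanishes because `p x_k` is itself the image of a rotation.
    have h : p * X k ^ 1 = -rot i k (p * X i) := by
      rw [rot_mul, rot_X, hp i hi k hk, if_neg hik, if_pos rfl]
      ring
    rw [h, map_neg, LinearMap.neg_apply, fischer_rot, hg i hi k hk]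
    simp [sphereMoment]
  | more a ih _ =>
    intro p hp
    have h := fischer_mul_X_pow_add_two hk hp hg a
    rw [ih (mul_mem hp (normSqOn_mem_rotInvariants T)), mul_assoc p, ← pow_succ'] at h
    have hpos : (0 : ℝ) < T.card + a := by
      have : (2 : ℝ) ≤ T.card := by exact_mod_cast hT
      positivity
    rw [Nat.add_div_right _ two_pos, sphereMoment_add_two, div_mul_eq_mul_div, div_mul_eq_mul_div,
      eq_div_iff hpos.ne']
    linarith

theorem fischer_aeval_sub_kacOp {S : Finset σ} {j k : σ} (hj : j ∈ S) (hk : k ∈ S) (hkj : k ≠ j)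
    (hT : 2 ≤ (S.erase j).card) (h : Polynomial (rotInvariants S)) {g : MvPolynomial σ ℝ}
    (hg : g ∈ rotInvariants (S.erase j)) :
    fischer (Polynomial.aeval (X k : MvPolynomial σ ℝ) h) g =
      fischer (Polynomial.aeval (X j : MvPolynomial σ ℝ)
        (kacOp (S.erase j).card (invNormSq S) h)) g := by
  induction h using Polynomial.induction_on' with
  | add p q hp hq => simp only [map_add, LinearMap.add_apply, hp, hq]
  | monomial a p =>
    have hp : (p : MvPolynomial σ ℝ) ∈ rotInvariants (S.erase j) :=
      rotInvariants_anti (Finset.erase_subset _ _) p.2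
    have h1 := fischer_mul_X_pow hT (Finset.mem_erase.mpr ⟨hkj, hk⟩) hg a hp
    rw [kacOp_monomial, map_smul, aeval_kacPoly hj, Polynomial.aeval_monomial, Algebra.smul_def p,
      mul_smul_comm, map_smul, LinearMap.smul_apply, smul_eq_mul]
    exact h1

/-- The bridge from several variables to one: projecting `h(x_k)` onto the invariants of `S \ {j}`
is `kacOp` applied to `h`, read in `x_j`. -/
theorem toPoly_rotAverage_erase {S : Finset σ} {j k : σ} (hj : j ∈ S) (hk : k ∈ S) (hkj : k ≠ j)
    (hT : 2 ≤ (S.erase j).card) {h : Polynomial (rotInvariants S)} {d : ℕ} {f : HomPoly σ d}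
    (hf : Polynomial.aeval (X k : MvPolynomial σ ℝ) h = toPoly f) :
    toPoly (rotAverage (S.erase j) d f) =
      Polynomial.aeval (X j : MvPolynomial σ ℝ) (kacOp (S.erase j).card (invNormSq S) h) := by
  refine rotAverage_eq_of_fischer (aeval_X_mem_rotInvariants_erase S j _) fun p hp => ?_
  rw [← hf, map_sub, LinearMap.sub_apply, fischer_aeval_sub_kacOp hj hk hkj hT h hp, sub_self]

end Average

end Kac

namespace Kac

/-! ### Eigenvectors of the sum of the one-particle projections -/

section Spectrum

open MvPolynomial

variable {σ : Type*} [DecidableEq σ] [Fintype σ]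

/-- The operator only produces even powers, so an eigenvector with nonzero eigenvalue is even. -/
theorem polynomial_eq_of_natDegree_eq_four {R : Type*} [CommRing R] [Algebra ℝ R] [IsDomain R]
    {m : ℕ} {ω : R} {κ : ℝ} (hκ : κ ≠ 0) {s : Polynomial R} (h : kacOp m ω s = κ • s)
    (hs : s.natDegree = 4) :
    s = Polynomial.C (s.coeff 4) * Polynomial.X ^ 4 + Polynomial.C (s.coeff 2) * Polynomial.X ^ 2 +
      Polynomial.C (s.coeff 0) := by
  have hodd : ∀ b, s.coeff (2 * b + 1) = 0 := by
    intro b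
    have h1 := coeff_kacOp_odd m ω s b
    rw [h, Polynomial.coeff_smul] at h1
    exact (smul_eq_zero_iff_right hκ).mp h1
  have h1 := hodd 0
  have h3 := hodd 1
  conv_lhs => rw [s.as_sum_range_C_mul_X_pow, hs]
  simp only [Finset.sum_range_succ, Finset.sum_range_zero]
  norm_num at h1 h3
  rw [h1, h3]
  simp
  ring

/-- The system splits along the permutation symmetry. The sum of the `η_k` is an eigenvector for `(μ
- 1)/m`, while each deviation from the mean would have eigenvalue `-(μ - 1) < -1/m`, which is
impossible unless it is zero. -/
theorem kacOp_system {ι R : Type*} [DecidableEq ι] [CommRing R] [Algebra ℝ R] [IsDomain R]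
    {m : ℕ} (hm : 2 ≤ m) {ω : R} {S : Finset ι} (hS : S.card = m + 1) {η : ι → Polynomial R}
    {μ : ℝ} (hμ : 1 / (m : ℝ) < μ - 1)
    (h : ∀ j ∈ S, η j + ∑ k ∈ S.erase j, kacOp m ω (η k) = μ • η j) :
    kacOp m ω (∑ k ∈ S, η k) = ((μ - 1) / m) • ∑ k ∈ S, η k ∧
      ∀ j ∈ S, η j = ((m : ℝ) + 1)⁻¹ • ∑ k ∈ S, η k := by
  have hm0 : (0 : ℝ) < m := by positivity
  set K := kacOp m ω with hK
  set s := ∑ k ∈ S, η k with hs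
  have hKs : K s = ∑ k ∈ S, K (η k) := map_sum _ _ _
  have hj : ∀ j ∈ S, η j + (K s - K (η j)) = μ • η j := fun j hj => by
    rw [← h j hj, hKs, ← Finset.add_sum_erase S (fun k => K (η k)) hj, add_sub_cancel_left]
  have hsum : (μ - 1) • s = (m : ℝ) • K s := by
    have h1 := Finset.sum_congr rfl hj
    rw [Finset.sum_add_distrib, Finset.sum_sub_distrib, ← Finset.smul_sum, ← hKs, ← hs,
      Finset.sum_const, hS, ← Nat.cast_smul_eq_nsmul ℝ] at h1
    push_cast at h1
    rw [sub_smul, ← h1]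
    module
  have hKs' : K s = ((μ - 1) / m) • s := by
    rw [div_eq_inv_mul, mul_smul, hsum, smul_smul, inv_mul_cancel₀ hm0.ne', one_smul]
  refine ⟨hKs', fun j hjS => ?_⟩
  by_contra hne
  have h1 : K (η j - ((m : ℝ) + 1)⁻¹ • s) = (-(μ - 1)) • (η j - ((m : ℝ) + 1)⁻¹ • s) := by
    have h2 : K (η j) = K s + (1 - μ) • η j := by
      rw [sub_smul, ← hj j hjS]; module
    rw [map_sub, hK, kacOp_real_smul, ← hK, h2, hKs']
    match_scalars
    · field_simp
      ring
    · ring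
  have h2 := eq_kacEigenvalue (sub_ne_zero.mpr hne) h1
  have h3 := neg_inv_le_kacEigenvalue (show 1 ≤ m by omega)
    (η j - ((m : ℝ) + 1)⁻¹ • s).natDegree
  rw [← h2] at h3
  linarith

theorem eq_of_sum_rotAverage_eq_smul {S : Finset σ} {m : ℕ} (hm : 2 ≤ m) (hS : S.card = m + 1)
    {d : ℕ} {f : HomPoly σ d} {μ : ℝ} (hM : ∑ k ∈ S, rotAverage (S.erase k) d f = μ • f)
    (hμ : 1 / (m : ℝ) < μ - 1) :
    ∃ s : Polynomial (rotInvariants S),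
      kacOp m (invNormSq S) s = ((μ - 1) / m) • s ∧
      toPoly f = ∑ j ∈ S, Polynomial.aeval (X j : MvPolynomial σ ℝ) s := by
  have hm0 : (0 : ℝ) < m := by positivity
  have hμ1 : 0 < μ - 1 := lt_trans (by positivity) hμ
  have hμ0 : μ ≠ 0 := by linarith
  have hcard : ∀ k ∈ S, (S.erase k).card = m := fun k hk => by
    rw [Finset.card_erase_of_mem hk, hS, Nat.add_sub_cancel]
  have hex : ∀ k, ∃ h : Polynomial (rotInvariants S), k ∈ S →
      Polynomial.aeval (X k : MvPolynomial σ ℝ) h = toPoly (rotAverage (S.erase k) d f) := by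
    intro k
    by_cases hk : k ∈ S
    · obtain ⟨h, hh⟩ := exists_aeval_X_eq hk (by rw [hcard k hk]; exact hm)
        (rotAverage_mem (S.erase k) f)
      exact ⟨h, fun _ => hh⟩
    · exact ⟨0, fun h => absurd h hk⟩
  choose η hη using hex
  have hsys : ∀ j ∈ S, η j + ∑ k ∈ S.erase j, kacOp m (invNormSq S) (η k) = μ • η j := by
    intro j hj
    refine aeval_X_injective hj (by omega) ?_
    -- Projecting the eigenvalue equation onto the invariants of `S \ {j}` makes every term a
    -- polynomial in `x_j`.
    have h1 := congrArg (fun g => toPoly (rotAverage (S.erase j) d g)) hM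
    simp only [map_sum, map_smul] at h1
    rw [← Finset.add_sum_erase _ _ hj, rotAverage_eq_self (rotAverage_mem _ _), ← hη j hj,
      Finset.sum_congr rfl fun k hk => by
        rw [toPoly_rotAverage_erase hj (Finset.mem_of_mem_erase hk) (Finset.ne_of_mem_erase hk)
          (by rw [hcard j hj]; exact hm) (hη k (Finset.mem_of_mem_erase hk)), hcard j hj],
      ← map_sum, ← map_add] at h1
    rw [h1, ← algebraMap_smul (rotInvariants S) μ (η j), map_smul, algebraMap_smul]
  obtain ⟨hK, heq⟩ := kacOp_system hm hS hμ hsys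
  refine ⟨(μ⁻¹ * ((m : ℝ) + 1)⁻¹) • ∑ k ∈ S, η k, ?_, ?_⟩
  · rw [kacOp_real_smul, hK, smul_comm]
  · have h1 : toPoly f = μ⁻¹ • ∑ j ∈ S, toPoly (rotAverage (S.erase j) d f) := by
      rw [← map_sum, hM, map_smul, smul_smul, inv_mul_cancel₀ hμ0, one_smul]
    rw [h1, Finset.smul_sum]
    refine Finset.sum_congr rfl fun j hjS => ?_
    rw [← hη j hjS, mul_smul, ← heq j hjS, ← algebraMap_smul (rotInvariants S) μ⁻¹ (η j), map_smul,
      algebraMap_smul]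

theorem eigenvalue_sum_rotAverage {S : Finset σ} {m : ℕ} (hm : 2 ≤ m) (hS : S.card = m + 1)
    {d : ℕ} {f : HomPoly σ d} {μ : ℝ} (hM : ∑ k ∈ S, rotAverage (S.erase k) d f = μ • f)
    (hμ : 1 / (m : ℝ) < μ - 1) (hf : f ≠ 0)
    (horth : ∀ g : HomPoly σ d, toPoly g ∈ rotInvariants S → inner ℝ f g = 0) :
    μ - 1 ≤ 3 / (m + 2) ∧ (μ - 1 = 3 / (m + 2) →
      ∃ a ∈ rotInvariants S, ∃ b ∈ rotInvariants S, ∃ c ∈ rotInvariants S,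
        toPoly f = ∑ j ∈ S, (a * X j ^ 4 + b * X j ^ 2 + c)) := by
  obtain ⟨s, hK, hfs⟩ := eq_of_sum_rotAverage_eq_smul hm hS hM hμ
  have hm0 : (0 : ℝ) < m := by positivity
  have hμ1 : 0 < μ - 1 := lt_trans (by positivity) hμ
  have hs : s ≠ 0 := by
    rintro rfl
    refine hf (toPoly_injective ?_)
    rw [hfs]
    simp
  have hκ := eq_kacEigenvalue hs hK
  -- A constant `s` would make `f` invariant, hence orthogonal to itself.
  have hdeg : s.natDegree ≠ 0 := by
    intro h0
    refine hf (inner_self_eq_zero (𝕜 := ℝ).mp (horth f ?_))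
    rw [hfs, Polynomial.eq_C_of_natDegree_eq_zero h0]
    refine sum_mem fun j _ => ?_
    rw [Polynomial.aeval_C]
    exact (s.coeff 0).2
  have hle := kacEigenvalue_le hm hdeg
  rw [← hκ] at hle
  have hiff : (3 : ℝ) / (m * (m + 2)) = 3 / (m + 2) / m := by field_simp
  rw [hiff] at hle
  refine ⟨(div_le_div_iff_of_pos_right hm0).mp hle.1, fun he => ?_⟩
  have h4 := hle.2 (by rw [he])
  have hs4 := polynomial_eq_of_natDegree_eq_four (div_ne_zero hμ1.ne' hm0.ne') hK h4
  refine ⟨s.coeff 4, (s.coeff 4).2, s.coeff 2, (s.coeff 2).2, s.coeff 0, (s.coeff 0).2, ?_⟩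
  rw [hfs]
  refine Finset.sum_congr rfl fun j _ => ?_
  conv_lhs => rw [hs4]
  simp only [map_add, map_mul, map_pow, Polynomial.aeval_C, Polynomial.aeval_X]
  rfl

end Spectrum

end Kac

namespace Kac

/-! ### The induction on the number of particles -/

section QuadraticForm

theorem inner_le_of_eigenvalue_le {V : Type*} [NormedAddCommGroup V] [InnerProductSpace ℝ V]
    [FiniteDimensional ℝ V] {T : V →ₗ[ℝ] V} (hT : T.IsSymmetric) {c : ℝ}
    (h : ∀ (μ : ℝ) (f : V), f ≠ 0 → T f = μ • f → μ ≤ c) (f : V) :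
    inner ℝ (T f) f ≤ c * ‖f‖ ^ 2 ∧ (inner ℝ (T f) f = c * ‖f‖ ^ 2 → T f = c • f) := by
  let b := hT.eigenvectorBasis rfl
  have hle : ∀ i, hT.eigenvalues rfl i ≤ c := fun i =>
    h _ (b i) (b.orthonormal.ne_zero i) (hT.apply_eigenvectorBasis rfl i)
  have hrepr : ∀ i, b.repr (T f) i = hT.eigenvalues rfl i * b.repr f i :=
    hT.eigenvectorBasis_apply_self_apply rfl f
  have h1 : c * ‖f‖ ^ 2 - inner ℝ (T f) f =
      ∑ i, (c - hT.eigenvalues rfl i) * (b.repr f i) ^ 2 := by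
    rw [← b.repr.inner_map_map, ← b.repr.norm_map f, EuclideanSpace.norm_sq_eq, PiLp.inner_apply,
      Finset.mul_sum, ← Finset.sum_sub_distrib]
    refine Finset.sum_congr rfl fun i _ => ?_
    rw [hrepr]
    simp
    ring
  have hnn : ∀ i ∈ Finset.univ, 0 ≤ (c - hT.eigenvalues rfl i) * (b.repr f i) ^ 2 := fun i _ =>
    mul_nonneg (sub_nonneg.mpr (hle i)) (sq_nonneg _)
  refine ⟨sub_nonneg.mp (h1 ▸ Finset.sum_nonneg hnn), fun he => b.repr.injective ?_⟩
  rw [he, sub_self, eq_comm, Finset.sum_eq_zero_iff_of_nonneg hnn] at h1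
  ext i
  rw [hrepr, map_smul, PiLp.smul_apply, smul_eq_mul]
  rcases mul_eq_zero.mp (h1 i (Finset.mem_univ i)) with h2 | h2
  · rw [sub_eq_zero.mp h2]
  · rw [pow_eq_zero_iff two_ne_zero] at h2
    rw [h2, mul_zero, mul_zero]

open MvPolynomial

variable {σ : Type*} [DecidableEq σ]

/-- Double counting: a pair survives the deletion of `k` for the `|S| - 2` choices of `k` outside
it. -/
theorem sum_offDiag_erase (S : Finset σ) (q : σ × σ → ℝ) :
    ∑ k ∈ S, ∑ p ∈ (S.erase k).offDiag, q p = ((S.card : ℝ) - 2) * ∑ p ∈ S.offDiag, q p := by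
  have h1 : ∀ k ∈ S, ∑ p ∈ (S.erase k).offDiag, q p =
      ∑ p ∈ S.offDiag, if k ≠ p.1 ∧ k ≠ p.2 then q p else 0 := by
    intro k _
    rw [← Finset.sum_filter]
    refine Finset.sum_congr ?_ fun _ _ => rfl
    ext p
    simp only [Finset.mem_offDiag, Finset.mem_erase, Finset.mem_filter]
    tauto
  rw [Finset.sum_congr rfl h1, Finset.sum_comm, Finset.mul_sum]
  refine Finset.sum_congr rfl fun p hp => ?_
  rw [Finset.mem_offDiag] at hp
  have h2 : S.filter (fun k => k ≠ p.1 ∧ k ≠ p.2) = (S.erase p.1).erase p.2 := by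
    ext k
    simp only [Finset.mem_filter, Finset.mem_erase]
    tauto
  have hp2 : p.2 ∈ S.erase p.1 := Finset.mem_erase.mpr ⟨hp.2.2.symm, hp.2.1⟩
  have h3 := Finset.card_erase_add_one hp.1
  have h4 := Finset.card_erase_add_one hp2
  rw [← Finset.sum_filter, h2, Finset.sum_const, nsmul_eq_mul, ← h3, ← h4]
  push_cast
  ring

variable [Fintype σ]

theorem sum_norm_rotAverage_sq_le {S : Finset σ} {m : ℕ} (hm : 2 ≤ m) (hS : S.card = m + 1)
    {d : ℕ} (f : HomPoly σ d) :
    ∑ k ∈ S, ‖rotAverage (S.erase k) d f‖ ^ 2 - (m - 3 / (m + 2)) * ‖rotAverage S d f‖ ^ 2 ≤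
        (1 + 3 / (m + 2)) * ‖f‖ ^ 2 ∧
      (rotAverage S d f = 0 →
        ∑ k ∈ S, ‖rotAverage (S.erase k) d f‖ ^ 2 = (1 + 3 / (m + 2)) * ‖f‖ ^ 2 →
        ∑ k ∈ S, rotAverage (S.erase k) d f = (1 + 3 / (m + 2) : ℝ) • f) := by
  have hm' : (2 : ℝ) ≤ m := by exact_mod_cast hm
  -- On invariants the sum of projections equals `m + 1`. The subtracted multiple lowers this to
  -- exactly `1 + 3/(m+2)`, so one bound holds on the whole space, and an eigenvector with a larger
  -- eigenvalue is orthogonal to the invariants.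
  set T : HomPoly σ d →ₗ[ℝ] HomPoly σ d :=
    ∑ k ∈ S, rotAverage (S.erase k) d - (m - 3 / (m + 2) : ℝ) • rotAverage S d with hTdef
  have hTf : ∀ f, T f = ∑ k ∈ S, rotAverage (S.erase k) d f -
      (m - 3 / (m + 2) : ℝ) • rotAverage S d f := fun f => by
    rw [hTdef, LinearMap.sub_apply, LinearMap.sum_apply, LinearMap.smul_apply]
  have hT : T.IsSymmetric := by
    intro f g
    rw [hTf, hTf, inner_sub_left, inner_sub_right, sum_inner, inner_sum, inner_smul_left,
      inner_smul_right, rotAverage_isSymmetric S d f g]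
    congr 1
    exact Finset.sum_congr rfl fun k _ => rotAverage_isSymmetric (S.erase k) d f g
  have hinner : inner ℝ (T f) f = ∑ k ∈ S, ‖rotAverage (S.erase k) d f‖ ^ 2 -
      (m - 3 / (m + 2)) * ‖rotAverage S d f‖ ^ 2 := by
    rw [hTf, inner_sub_left, sum_inner, inner_smul_left, inner_rotAverage]
    simp only [inner_rotAverage]
    rfl
  have heig : ∀ (μ : ℝ) (f : HomPoly σ d), f ≠ 0 → T f = μ • f → μ ≤ 1 + 3 / (m + 2) := by
    intro μ f hf hμ
    by_contra hlt
    push Not at hlt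
    have horth : ∀ g : HomPoly σ d, toPoly g ∈ rotInvariants S → inner ℝ f g = 0 := by
      intro g hg
      have hTg : T g = (1 + 3 / (m + 2) : ℝ) • g := by
        rw [hTf, rotAverage_eq_self hg, Finset.sum_congr rfl fun k _ =>
          rotAverage_eq_self (rotInvariants_anti (Finset.erase_subset k S) hg), Finset.sum_const,
          hS, ← Nat.cast_smul_eq_nsmul ℝ]
        push_cast
        module
      have h1 := hT f g
      rw [hμ, hTg, inner_smul_left, inner_smul_right] at h1
      have h2 : (μ - (1 + 3 / (m + 2))) * inner ℝ f g = 0 := by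
        rw [sub_mul, sub_eq_zero]
        exact h1
      exact (mul_eq_zero.mp h2).resolve_left (by linarith)
    have hM : ∑ k ∈ S, rotAverage (S.erase k) d f = μ • f := by
      rw [← hμ, hTf, rotAverage_eq_zero horth, smul_zero, sub_zero]
    have h3 : 1 / (m : ℝ) < 3 / (m + 2) := by
      rw [div_lt_div_iff₀ (by positivity) (by positivity)]
      linarith
    have := (eigenvalue_sum_rotAverage hm hS hM (by linarith) hf horth).1
    linarith
  have hmain := inner_le_of_eigenvalue_le hT heig f
  rw [hinner] at hmain
  refine ⟨hmain.1, fun h0 he => ?_⟩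
  rw [← hmain.2 (by rw [he, h0]; simp), hTf, h0, smul_zero, sub_zero]

/-- With two particles both ordered pairs give the full projection, so equality holds with constant
`2`. The inductive step closes because `n + 2 - 3/(n+4) = (n+1)(n+5)/(n+4)`, and `n + 1` is the
multiplicity of each pair. -/
theorem offDiag_form_ge (n : ℕ) : ∀ (S : Finset σ), S.card = n + 2 → ∀ {d : ℕ} (f : HomPoly σ d),
    ((n : ℝ) + 4) / 2 * (‖f‖ ^ 2 - ‖rotAverage S d f‖ ^ 2) ≤
      ∑ p ∈ S.offDiag, ‖f - rotAverage {p.1, p.2} d f‖ ^ 2 := by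
  induction n with
  | zero =>
    intro S hS d f
    obtain ⟨a, b, hab, rfl⟩ := Finset.card_eq_two.mp hS
    have : ({a, b} : Finset σ).offDiag = {(a, b), (b, a)} := by
      ext ⟨x, y⟩
      simp only [Finset.mem_offDiag, Finset.mem_insert, Finset.mem_singleton, Prod.mk.injEq]
      constructor
      · rintro ⟨rfl | rfl, rfl | rfl, h⟩ <;> simp_all
      · rintro (⟨rfl, rfl⟩ | ⟨rfl, rfl⟩) <;> simp [hab, hab.symm]
    rw [this, Finset.sum_pair (by simp [hab]), norm_sub_rotAverage_sq, norm_sub_rotAverage_sq,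
      Finset.pair_comm b a]
    push_cast
    linarith
  | succ n ih =>
    intro S hS d f
    have h1 := (sum_norm_rotAverage_sq_le (show 2 ≤ n + 2 by omega) hS f).1
    have h2 : ∑ k ∈ S, ((n : ℝ) + 4) / 2 * (‖f‖ ^ 2 - ‖rotAverage (S.erase k) d f‖ ^ 2) ≤
        ∑ k ∈ S, ∑ p ∈ (S.erase k).offDiag, ‖f - rotAverage {p.1, p.2} d f‖ ^ 2 :=
      Finset.sum_le_sum fun k hk => ih (S.erase k)
        (by rw [Finset.card_erase_of_mem hk, hS]; rfl) f
    rw [sum_offDiag_erase, ← Finset.mul_sum, Finset.sum_sub_distrib, Finset.sum_const, hS,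
      nsmul_eq_mul] at h2
    push_cast at h1 h2 ⊢
    have hn : (0 : ℝ) < n + 1 := by positivity
    have h4 : ((n : ℝ) + 4) / 2 * ((n + 2 - 3 / (n + 2 + 2)) *
        (‖f‖ ^ 2 - ‖rotAverage S d f‖ ^ 2)) =
        (n + 1) * ((n + 1 + 4) / 2 * (‖f‖ ^ 2 - ‖rotAverage S d f‖ ^ 2)) := by
      field_simp
      ring
    have h5 : ((n : ℝ) + 4) / 2 * ((n + 2 - 3 / (n + 2 + 2)) *
        (‖f‖ ^ 2 - ‖rotAverage S d f‖ ^ 2)) ≤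
        ((n : ℝ) + 4) / 2 *
          ((n + 1 + 2) * ‖f‖ ^ 2 - ∑ k ∈ S, ‖rotAverage (S.erase k) d f‖ ^ 2) := by
      refine mul_le_mul_of_nonneg_left ?_ (by positivity)
      linarith
    refine le_of_mul_le_mul_left ?_ hn
    rw [← h4]
    refine h5.trans (h2.trans (le_of_eq ?_))
    ring

/-- Equality in the form forces equality in the last induction step, so `f` is a top eigenvector of
the sum of projections on the complement and thus quartic. With two particles there is no such step
and equality says nothing. -/
theorem eq_of_offDiag_form_eq {S : Finset σ} {n : ℕ} (hS : S.card = n + 3) {d : ℕ}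
    {f : HomPoly σ d} (hf : f ≠ 0)
    (horth : ∀ g : HomPoly σ d, toPoly g ∈ rotInvariants S → inner ℝ f g = 0)
    (he : ∑ p ∈ S.offDiag, ‖f - rotAverage {p.1, p.2} d f‖ ^ 2 = ((n : ℝ) + 5) / 2 * ‖f‖ ^ 2) :
    ∃ a ∈ rotInvariants S, ∃ b ∈ rotInvariants S, ∃ c ∈ rotInvariants S,
      toPoly f = ∑ j ∈ S, (a * X j ^ 4 + b * X j ^ 2 + c) := by
  have h0 := rotAverage_eq_zero horth
  have h1 := sum_norm_rotAverage_sq_le (show 2 ≤ n + 2 by omega) hS f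
  have h2 : ∑ k ∈ S, ((n : ℝ) + 4) / 2 * (‖f‖ ^ 2 - ‖rotAverage (S.erase k) d f‖ ^ 2) ≤
      ∑ k ∈ S, ∑ p ∈ (S.erase k).offDiag, ‖f - rotAverage {p.1, p.2} d f‖ ^ 2 :=
    Finset.sum_le_sum fun k hk => offDiag_form_ge n (S.erase k)
      (by rw [Finset.card_erase_of_mem hk, hS]; rfl) f
  rw [sum_offDiag_erase, ← Finset.mul_sum, Finset.sum_sub_distrib, Finset.sum_const, hS,
    nsmul_eq_mul, he] at h2
  push_cast at h1 h2
  have hn : (0 : ℝ) < n + 4 := by positivity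
  have h4 : ((n : ℝ) + 4) / 2 * ((n + 2 - 3 / (n + 2 + 2)) * ‖f‖ ^ 2) =
      (n + 3 - 2) * ((n + 5) / 2 * ‖f‖ ^ 2) := by
    field_simp
    ring
  rw [← h4] at h2
  have h5 := le_of_mul_le_mul_left h2 (by positivity)
  have h6 : ∑ k ∈ S, ‖rotAverage (S.erase k) d f‖ ^ 2 = (1 + 3 / (n + 2 + 2)) * ‖f‖ ^ 2 := by
    refine le_antisymm ?_ (by linarith)
    have := h1.1
    rw [h0, norm_zero] at this
    linarith
  have h7 := h1.2 h0 h6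
  refine (eigenvalue_sum_rotAverage (show 2 ≤ n + 2 by omega) hS (μ := 1 + 3 / (n + 2 + 2)) h7 ?_
    hf horth).2 ?_
  · push_cast
    rw [add_sub_cancel_left, div_lt_div_iff₀ (by positivity) (by positivity)]
    linarith [(Nat.cast_nonneg n : (0 : ℝ) ≤ n)]
  · push_cast
    ring

/-- The sum over all ordered pairs of the averages over the rotations of two coordinates. -/
noncomputable def pairSum (σ : Type*) [DecidableEq σ] [Fintype σ] (d : ℕ) :
    HomPoly σ d →ₗ[ℝ] HomPoly σ d :=
  ∑ p ∈ (Finset.univ : Finset σ).offDiag, rotAverage {p.1, p.2} d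

theorem pairSum_apply {d : ℕ} (f : HomPoly σ d) :
    pairSum σ d f = ∑ p ∈ (Finset.univ : Finset σ).offDiag, rotAverage {p.1, p.2} d f := by
  rw [pairSum, LinearMap.sum_apply]

theorem pairSum_isSymmetric (d : ℕ) : (pairSum σ d).IsSymmetric := by
  intro f g
  rw [pairSum_apply, pairSum_apply, sum_inner, inner_sum]
  exact Finset.sum_congr rfl fun p _ => rotAverage_isSymmetric {p.1, p.2} d f g

theorem offDiag_form_eq {d : ℕ} {f : HomPoly σ d} {μ : ℝ} (h : pairSum σ d f = μ • f) :
    ∑ p ∈ (Finset.univ : Finset σ).offDiag, ‖f - rotAverage {p.1, p.2} d f‖ ^ 2 =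
      (((Finset.univ : Finset σ).offDiag.card : ℝ) - μ) * ‖f‖ ^ 2 := by
  have h1 : inner ℝ (pairSum σ d f) f =
      ∑ p ∈ (Finset.univ : Finset σ).offDiag, ‖rotAverage {p.1, p.2} d f‖ ^ 2 := by
    rw [pairSum_apply, sum_inner]
    simp only [inner_rotAverage]
  rw [h, inner_smul_left, real_inner_self_eq_norm_sq] at h1
  simp only [norm_sub_rotAverage_sq]
  rw [Finset.sum_sub_distrib, ← h1, Finset.sum_const, nsmul_eq_mul, sub_mul]
  rfl

theorem pairSum_eigenvector {n : ℕ} (hσ : Fintype.card σ = n + 2) {d : ℕ} {f : HomPoly σ d}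
    (hf : f ≠ 0) {μ : ℝ} (h : pairSum σ d f = μ • f) :
    toPoly f ∈ rotInvariants (Finset.univ : Finset σ) ∨
      (μ ≤ (n + 2) * (n + 1) - (n + 4) / 2 ∧
        (1 ≤ n → μ = (n + 2) * (n + 1) - (n + 4) / 2 →
          ∃ a ∈ rotInvariants (Finset.univ : Finset σ),
          ∃ b ∈ rotInvariants (Finset.univ : Finset σ),
          ∃ c ∈ rotInvariants (Finset.univ : Finset σ),
            toPoly f = ∑ j, (a * X j ^ 4 + b * X j ^ 2 + c))) := by
  have hcard : (Finset.univ : Finset σ).card = n + 2 := hσ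
  have hoff : ((Finset.univ : Finset σ).offDiag.card : ℝ) = (n + 2) * (n + 1) := by
    rw [Finset.offDiag_card, hcard, Nat.cast_sub (by nlinarith)]
    push_cast
    ring
  have hform := offDiag_form_eq h
  rw [hoff] at hform
  have hge := offDiag_form_ge n Finset.univ hcard f
  rw [hform] at hge
  have hfpos : 0 < ‖f‖ ^ 2 := by positivity
  -- This is the number of ordered pairs: only there does the form vanish, and then `f` is
  -- invariant.
  by_cases hμ : μ = (n + 2) * (n + 1)
  · left
    rw [hμ, sub_self, zero_mul, ← norm_sub_rotAverage_sq] at hge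
    have h0 : ‖f - rotAverage Finset.univ d f‖ ^ 2 = 0 :=
      le_antisymm (nonpos_of_mul_nonpos_right hge (by positivity)) (sq_nonneg _)
    rw [pow_eq_zero_iff two_ne_zero, norm_eq_zero, sub_eq_zero] at h0
    rw [h0]
    exact rotAverage_mem _ _
  · right
    have horth : ∀ g : HomPoly σ d, toPoly g ∈ rotInvariants (Finset.univ : Finset σ) →
        inner ℝ f g = 0 := by
      intro g hg
      have hg' : pairSum σ d g = ((n + 2) * (n + 1) : ℝ) • g := by
        have hfix : ∀ p ∈ (Finset.univ : Finset σ).offDiag, rotAverage {p.1, p.2} d g = g :=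
          fun p _ => rotAverage_eq_self (rotInvariants_anti (Finset.subset_univ _) hg)
        rw [pairSum_apply, Finset.sum_congr rfl hfix, Finset.sum_const, ← Nat.cast_smul_eq_nsmul ℝ, hoff]
      have h1 := pairSum_isSymmetric d f g
      rw [h, hg', real_inner_smul_left, real_inner_smul_right] at h1
      have h2 : (μ - (n + 2) * (n + 1)) * inner ℝ f g = 0 := by
        rw [sub_mul, sub_eq_zero]
        exact h1
      exact (mul_eq_zero.mp h2).resolve_left (sub_ne_zero.mpr hμ)
    rw [rotAverage_eq_zero horth, norm_zero] at hge
    refine ⟨?_, fun hn he => ?_⟩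
    · have : ((n : ℝ) + 4) / 2 ≤ (n + 2) * (n + 1) - μ := by
        refine le_of_mul_le_mul_right ?_ hfpos
        linarith
      linarith
    · obtain ⟨k, rfl⟩ := Nat.exists_eq_add_of_le' hn
      refine eq_of_offDiag_form_eq (n := k) (by rw [hcard]) hf horth ?_
      rw [hform, he]
      push_cast
      ring

end QuadraticForm

end Kac

namespace Kac

open MvPolynomial

/-! ### Decomposition of a polynomial along one rotation -/

section RotHom

variable {σ : Type*}

/-- The infinitesimal rotation on homogeneous polynomials. -/
noncomputable def rotHom (i j : σ) (d : ℕ) : HomPoly σ d →ₗ[ℝ] HomPoly σ d where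
  toFun f := ⟨rot i j (toPoly f), rot_isHomogeneous i j (toPoly_isHomogeneous f)⟩
  map_add' f g := Subtype.ext (by simp only [map_add]; rfl)
  map_smul' r f := Subtype.ext (by simp only [map_smul, Derivation.map_smul]; rfl)

theorem toPoly_rotHom (i j : σ) {d : ℕ} (f : HomPoly σ d) :
    toPoly (rotHom i j d f) = rot i j (toPoly f) := rfl

theorem mem_rotInvariants_pair [DecidableEq σ] {i j : σ} {f : MvPolynomial σ ℝ} :
    f ∈ rotInvariants {i, j} ↔ rot i j f = 0 := by
  refine ⟨fun h => h i (by simp) j (by simp), fun h => ?_⟩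
  intro a ha b hb
  simp only [Finset.mem_insert, Finset.mem_singleton] at ha hb
  rcases ha with rfl | rfl <;> rcases hb with rfl | rfl
  · exact rot_self _ _
  · exact h
  · rw [rot_swap, h, neg_zero]
  · exact rot_self _ _

/-- In finite dimension the orthogonal complement of a kernel is the range of the adjoint, and here
the adjoint is `-rot i j`. -/
theorem exists_sub_rotAverage_eq_rot [DecidableEq σ] [Fintype σ] (i j : σ) {d : ℕ}
    (f : HomPoly σ d) :
    ∃ g : MvPolynomial σ ℝ, toPoly f = toPoly (rotAverage {i, j} d f) + rot i j g := by
  have hadj : LinearMap.adjoint (rotHom i j d) = -rotHom i j d := by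
    symm
    rw [LinearMap.eq_adjoint_iff]
    intro f g
    rw [LinearMap.neg_apply, inner_neg_left, homPoly_inner, homPoly_inner, toPoly_rotHom,
      toPoly_rotHom, fischer_rot, neg_neg]
  have h : f - rotAverage {i, j} d f ∈ (LinearMap.ker (rotHom i j d))ᗮ := by
    rw [Submodule.mem_orthogonal']
    intro g hg
    refine inner_sub_rotAverage f (mem_rotInvariants_pair.mpr ?_)
    rw [← toPoly_rotHom, LinearMap.mem_ker.mp hg, map_zero]
  rw [LinearMap.orthogonal_ker, hadj] at h
  obtain ⟨g, hg⟩ := h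
  refine ⟨-toPoly g, ?_⟩
  rw [map_neg, ← toPoly_rotHom, ← map_neg toPoly, ← LinearMap.neg_apply, hg, map_sub]
  exact (add_sub_cancel _ _).symm

end RotHom

/-! ### Collision averages of polynomials on the sphere -/

section Collision

variable {N : ℕ}

/-- The restriction of a polynomial to the sphere. -/
noncomputable def evalSphere (f : MvPolynomial (Fin N) ℝ) (v : KacSphere N) : ℝ :=
  eval (fun k => (v : EuclideanSpace ℝ (Fin N)) k) f

theorem collideVec_apply (i j : Fin N) (θ : ℝ) (v : EuclideanSpace ℝ (Fin N)) (k : Fin N) :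
    collideVec i j θ v k = if k = i then Real.cos θ * v i - Real.sin θ * v j
      else if k = j then Real.sin θ * v i + Real.cos θ * v j else v k := rfl

theorem hasDerivAt_eval_collideVec {i j : Fin N} (hij : i ≠ j) (v : EuclideanSpace ℝ (Fin N))
    (f : MvPolynomial (Fin N) ℝ) (θ : ℝ) :
    HasDerivAt (fun θ => eval (fun k => collideVec i j θ v k) f)
      (eval (fun k => collideVec i j θ v k) (rot i j f)) θ := by
  induction f using MvPolynomial.induction_on with
  | C a => simpa using hasDerivAt_const θ a
  | add p q hp hq => simpa only [map_add] using hp.fun_add hq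
  | mul_X p k hp =>
    have hk : HasDerivAt (fun θ => collideVec i j θ v k)
        (eval (fun k => collideVec i j θ v k) (rot i j (X k))) θ := by
      have hi := ((Real.hasDerivAt_cos θ).mul_const (v i)).fun_sub
        ((Real.hasDerivAt_sin θ).mul_const (v j))
      have hj := ((Real.hasDerivAt_sin θ).mul_const (v i)).fun_add
        ((Real.hasDerivAt_cos θ).mul_const (v j))
      rw [rot_X]
      by_cases h1 : k = i
      · subst h1
        simp only [collideVec_apply, if_pos, if_neg hij, if_neg hij.symm, zero_sub, map_neg, eval_X]
        exact hi.congr_deriv (by ring)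
      · by_cases h2 : k = j
        · subst h2
          simp only [collideVec_apply, if_pos, if_neg h1, sub_zero, eval_X]
          exact hj.congr_deriv (by ring)
        · simp only [collideVec_apply, if_neg h1, if_neg h2, sub_zero, map_zero]
          exact hasDerivAt_const θ _
    simp only [rot_mul, map_mul, map_add, eval_X]
    exact (hp.fun_mul hk).congr_deriv (by ring)

theorem continuous_eval_collideVec {i j : Fin N} (hij : i ≠ j) (v : EuclideanSpace ℝ (Fin N))
    (f : MvPolynomial (Fin N) ℝ) : Continuous fun θ => eval (fun k => collideVec i j θ v k) f :=
  continuous_iff_continuousAt.mpr fun θ => (hasDerivAt_eval_collideVec hij v f θ).continuousAt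

theorem integral_eval_collideVec_rot {i j : Fin N} (hij : i ≠ j) (v : EuclideanSpace ℝ (Fin N))
    (f : MvPolynomial (Fin N) ℝ) :
    ∫ θ in (-Real.pi)..Real.pi, eval (fun k => collideVec i j θ v k) (rot i j f) = 0 := by
  rw [intervalIntegral.integral_eq_sub_of_hasDerivAt
    (fun θ _ => hasDerivAt_eval_collideVec hij v f θ)
    ((continuous_eval_collideVec hij v _).intervalIntegrable _ _)]
  simp [collideVec_apply]

theorem eval_collideVec_of_rot_eq_zero {i j : Fin N} (hij : i ≠ j)
    (v : EuclideanSpace ℝ (Fin N)) {f : MvPolynomial (Fin N) ℝ} (hf : rot i j f = 0) (θ : ℝ) :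
    eval (fun k => collideVec i j θ v k) f = eval (fun k => v k) f := by
  have h := is_const_of_deriv_eq_zero
    (fun θ => (hasDerivAt_eval_collideVec hij v f θ).differentiableAt)
    (fun θ => by rw [(hasDerivAt_eval_collideVec hij v f θ).deriv, hf, map_zero]) θ 0
  rw [h]
  refine congrArg (fun x => eval x f) (funext fun k => ?_)
  rw [collideVec_apply]
  split_ifs with h1 h2 <;> simp_all

theorem pairAverage_evalSphere_add_rot {ρ : ℝ → ℝ} (hρ : ∀ θ, ρ θ = 1 / (2 * Real.pi))
    {i j : Fin N} (hij : i ≠ j) {f : MvPolynomial (Fin N) ℝ} (hf : rot i j f = 0)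
    (g : MvPolynomial (Fin N) ℝ) (v : KacSphere N) :
    pairAverage ρ hij (evalSphere (f + rot i j g)) v = evalSphere f v := by
  have h : ∀ θ, ρ θ * evalSphere (f + rot i j g) (collide hij θ v) =
      1 / (2 * Real.pi) * evalSphere f v + 1 / (2 * Real.pi) *
        eval (fun k => collideVec i j θ (v : EuclideanSpace ℝ (Fin N)) k) (rot i j g) := by
    intro θ
    rw [hρ, ← mul_add]
    congr 1
    change eval (fun k => collideVec i j θ v k) (f + rot i j g) = _
    rw [map_add, eval_collideVec_of_rot_eq_zero hij _ hf θ]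
    rfl
  have hc : Continuous fun θ => 1 / (2 * Real.pi) *
      eval (fun k => collideVec i j θ (v : EuclideanSpace ℝ (Fin N)) k) (rot i j g) :=
    continuous_const.mul (continuous_eval_collideVec hij _ _)
  rw [pairAverage, intervalIntegral.integral_congr fun θ _ => h θ, intervalIntegral.integral_add
    (continuous_const.intervalIntegrable _ _)
    (hc.intervalIntegrable _ _),
    intervalIntegral.integral_const, intervalIntegral.integral_const_mul,
    integral_eval_collideVec_rot hij]
  have := Real.pi_pos
  rw [smul_eq_mul]
  field_simp
  ring

/-- The invariant part is constant along the orbit of the collision and the `rot` part is a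
derivative in `θ`, with zero integral over a period. Only here is the Fischer projection identified
with the analytic average. -/
theorem pairAverage_evalSphere_toPoly {ρ : ℝ → ℝ} (hρ : ∀ θ, ρ θ = 1 / (2 * Real.pi))
    {i j : Fin N} (hij : i ≠ j) {d : ℕ} (f : HomPoly (Fin N) d) (v : KacSphere N) :
    pairAverage ρ hij (evalSphere (toPoly f)) v =
      evalSphere (toPoly (rotAverage {i, j} d f)) v := by
  obtain ⟨g, hg⟩ := exists_sub_rotAverage_eq_rot i j f
  rw [hg]
  exact pairAverage_evalSphere_add_rot hρ hij (mem_rotInvariants_pair.mp (rotAverage_mem _ f)) g v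

theorem two_mul_sum_lt (q : Fin N → Fin N → ℝ) (hq : ∀ i j, q i j = q j i) :
    2 * ∑ p : {p : Fin N × Fin N // p.1 < p.2}, q p.1.1 p.1.2 =
      ∑ p ∈ (Finset.univ : Finset (Fin N)).offDiag, q p.1 p.2 := by
  have h1 : ∑ p : {p : Fin N × Fin N // p.1 < p.2}, q p.1.1 p.1.2 =
      ∑ p ∈ (Finset.univ : Finset (Fin N × Fin N)).filter (fun p => p.1 < p.2), q p.1 p.2 :=
    (Finset.sum_subtype _ (by simp) fun p : Fin N × Fin N => q p.1 p.2).symm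
  have h2 : ∑ p ∈ (Finset.univ : Finset (Fin N × Fin N)).filter (fun p => p.1 < p.2), q p.1 p.2 =
      ∑ p ∈ (Finset.univ : Finset (Fin N × Fin N)).filter (fun p => p.2 < p.1), q p.1 p.2 :=
    Finset.sum_nbij' Prod.swap Prod.swap (by simp) (by simp) (by simp) (by simp)
      fun p _ => hq _ _
  have h3 : (Finset.univ : Finset (Fin N)).offDiag =
      (Finset.univ : Finset (Fin N × Fin N)).filter (fun p => p.1 < p.2) ∪
        (Finset.univ : Finset (Fin N × Fin N)).filter (fun p => p.2 < p.1) := by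
    ext p
    simp [lt_or_lt_iff_ne]
  rw [h3, Finset.sum_union, ← h2, h1, two_mul]
  rw [Finset.disjoint_filter]
  exact fun p _ h => not_lt.mpr h.le

theorem cast_choose_two (n : ℕ) : (((n + 2).choose 2 : ℕ) : ℝ) = (n + 2) * (n + 1) / 2 := by
  rw [Nat.cast_choose_two]
  push_cast
  ring

theorem Q_evalSphere_eigenvector {n : ℕ} {ρ : ℝ → ℝ} (hρ : ∀ θ, ρ θ = 1 / (2 * Real.pi))
    {d : ℕ} {f : HomPoly (Fin (n + 2)) d} {μ : ℝ} (h : pairSum (Fin (n + 2)) d f = μ • f) :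
    Q ρ (evalSphere (toPoly f)) =
      fun v => μ / ((n + 2) * (n + 1)) * evalSphere (toPoly f) v := by
  funext v
  have h1 : ∀ p : {p : Fin (n + 2) × Fin (n + 2) // p.1 < p.2},
      pairAverage ρ (ne_of_lt p.2) (evalSphere (toPoly f)) v =
        evalSphere (toPoly (rotAverage {p.1.1, p.1.2} d f)) v := fun p =>
    pairAverage_evalSphere_toPoly hρ _ f v
  have h2 := two_mul_sum_lt (fun i j => evalSphere (toPoly (rotAverage {i, j} d f)) v)
    fun i j => by rw [Finset.pair_comm]
  have h3 : ∑ p ∈ (Finset.univ : Finset (Fin (n + 2))).offDiag,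
      evalSphere (toPoly (rotAverage {p.1, p.2} d f)) v = μ * evalSphere (toPoly f) v := by
    simp only [evalSphere]
    rw [← map_sum, ← map_sum, ← pairSum_apply, h, map_smul, smul_eval]
  rw [Q, Finset.sum_congr rfl fun p _ => h1 p, cast_choose_two]
  rw [h3] at h2
  field_simp
  linarith

theorem sum_sq_sphere (v : KacSphere N) :
    ∑ k, (v : EuclideanSpace ℝ (Fin N)) k ^ 2 = N := by
  have h := mem_sphere_zero_iff_norm.mp v.2
  have h2 := EuclideanSpace.real_norm_sq_eq (v : EuclideanSpace ℝ (Fin N))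
  rw [h, Real.sq_sqrt (Nat.cast_nonneg N)] at h2
  exact h2.symm

/-- A polynomial restricting to `gapFunction`. -/
noncomputable def gapPoly (N : ℕ) : MvPolynomial (Fin N) ℝ :=
  ∑ j : Fin N, (X j ^ 4 - C (3 * (N : ℝ) / ((N : ℝ) + 2)))

theorem evalSphere_gapPoly (N : ℕ) : evalSphere (gapPoly N) = gapFunction N := by
  funext v
  simp [evalSphere, gapPoly, gapFunction]

theorem pairAverage_gapFunction {ρ : ℝ → ℝ} (hρ : ∀ θ, ρ θ = 1 / (2 * Real.pi))
    {i j : Fin N} (hij : i ≠ j) (v : KacSphere N) :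
    pairAverage ρ hij (gapFunction N) v = gapFunction N v -
      1 / 4 * ((v : EuclideanSpace ℝ (Fin N)) i ^ 4 + (v : EuclideanSpace ℝ (Fin N)) j ^ 4 -
        6 * ((v : EuclideanSpace ℝ (Fin N)) i ^ 2 * (v : EuclideanSpace ℝ (Fin N)) j ^ 2)) := by
  -- In polar coordinates of the `(i, j)` plane, `x_i⁴ + x_j⁴ = (3 + cos 4φ) r⁴/4`. The oscillating
  -- part is the `φ`-derivative of `r⁴ sin 4φ / 16`, which is `w`.
  set w : MvPolynomial (Fin N) ℝ := C (1 / 4) * (X i ^ 3 * X j - X i * X j ^ 3) with hw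
  have hX : ∀ k, rot i j (X k : MvPolynomial (Fin N) ℝ) =
      (if k = j then X i else 0) - (if k = i then X j else 0) := rot_X i j
  have hXi := hX i
  have hXj := hX j
  rw [if_neg hij, if_pos rfl, zero_sub] at hXi
  rw [if_pos rfl, if_neg hij.symm, sub_zero] at hXj
  have hrw : rot i j w = C (1 / 4) * (X i ^ 4 + X j ^ 4 - 6 * (X i ^ 2 * X j ^ 2)) := by
    rw [hw, rot_mul, map_sub, rot_mul, rot_mul, Derivation.leibniz_pow, Derivation.leibniz_pow,
      hXi, hXj, ← algebraMap_eq, Derivation.map_algebraMap]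
    simp only [nsmul_eq_mul, smul_eq_mul]
    push_cast
    ring
  have hpow : ∀ k, rot i j (X k ^ 4 : MvPolynomial (Fin N) ℝ) =
      (if k = j then 4 * X j ^ 3 * X i else 0) - (if k = i then 4 * X i ^ 3 * X j else 0) := by
    intro k
    rw [Derivation.leibniz_pow, hX]
    simp only [nsmul_eq_mul, smul_eq_mul]
    push_cast
    split_ifs with h1 h2 h2 <;> simp_all <;> ring
  have hzero : rot i j (gapPoly N - rot i j w) = 0 := by
    have h1 : rot i j (gapPoly N) = 4 * X j ^ 3 * X i - 4 * X i ^ 3 * X j := by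
      have hc : ∀ k, rot i j (X k ^ 4 - C (3 * (N : ℝ) / ((N : ℝ) + 2)) : MvPolynomial (Fin N) ℝ) =
          (if k = j then 4 * X j ^ 3 * X i else 0) - (if k = i then 4 * X i ^ 3 * X j else 0) := by
        intro k
        rw [map_sub, hpow, ← algebraMap_eq, Derivation.map_algebraMap, sub_zero]
      rw [gapPoly, map_sum, Finset.sum_congr rfl fun k _ => hc k, Finset.sum_sub_distrib,
        Finset.sum_ite_eq', Finset.sum_ite_eq', if_pos (Finset.mem_univ _),
        if_pos (Finset.mem_univ _)]
    have h6 : rot i j (6 : MvPolynomial (Fin N) ℝ) = 0 := by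
      have : (6 : MvPolynomial (Fin N) ℝ) = algebraMap ℝ _ 6 := (map_ofNat _ 6).symm
      rw [this, Derivation.map_algebraMap]
    have hC : rot i j (C (1 / 4) : MvPolynomial (Fin N) ℝ) = 0 := by
      rw [← algebraMap_eq, Derivation.map_algebraMap]
    have h4 : (C (1 / 4) : MvPolynomial (Fin N) ℝ) * 4 = 1 := by
      have : (4 : MvPolynomial (Fin N) ℝ) = C 4 := (map_ofNat C 4).symm
      rw [this, ← C_mul]
      norm_num
    have h2 : rot i j (rot i j w) =
        C (1 / 4) * 4 * (4 * X j ^ 3 * X i - 4 * X i ^ 3 * X j) := by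
      rw [hrw, rot_mul, map_sub, map_add, rot_mul, rot_mul, hpow, hpow, Derivation.leibniz_pow,
        Derivation.leibniz_pow, hXi, hXj, h6, hC, if_pos rfl, if_pos rfl, if_neg hij,
        if_neg hij.symm]
      simp only [nsmul_eq_mul, smul_eq_mul]
      push_cast
      ring
    rw [map_sub, h1, h2, h4]
    ring
  have h := pairAverage_evalSphere_add_rot hρ hij hzero w v
  rw [sub_add_cancel, evalSphere_gapPoly] at h
  rw [h, evalSphere, map_sub, hrw, ← evalSphere, evalSphere_gapPoly]
  simp

/-- Summing the pair corrections and using `∑ x_k² = N`, the mixed terms become `N² - ∑ x_k⁴`; the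
constant `3N/(N+2)` is what makes the result proportional to the function. -/
theorem Q_gapFunction {n : ℕ} {ρ : ℝ → ℝ} (hρ : ∀ θ, ρ θ = 1 / (2 * Real.pi)) :
    Q ρ (gapFunction (n + 2)) =
      fun v => (1 - (n + 4) / (2 * ((n + 2) * (n + 1)))) * gapFunction (n + 2) v := by
  funext v
  set x : Fin (n + 2) → ℝ := fun k => (v : EuclideanSpace ℝ (Fin (n + 2))) k with hx
  have h1 : ∀ p : {p : Fin (n + 2) × Fin (n + 2) // p.1 < p.2},
      pairAverage ρ (ne_of_lt p.2) (gapFunction (n + 2)) v = gapFunction (n + 2) v -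
        1 / 4 * (x p.1.1 ^ 4 + x p.1.2 ^ 4 - 6 * (x p.1.1 ^ 2 * x p.1.2 ^ 2)) := fun p =>
    pairAverage_gapFunction hρ _ v
  have h2 := two_mul_sum_lt (fun i j => gapFunction (n + 2) v -
    1 / 4 * (x i ^ 4 + x j ^ 4 - 6 * (x i ^ 2 * x j ^ 2))) fun i j => by ring
  have hG : gapFunction (n + 2) v = ∑ k, x k ^ 4 - 3 * (n + 2) ^ 2 / (n + 4) := by
    rw [gapFunction, Finset.sum_sub_distrib, Finset.sum_const, Finset.card_univ, Fintype.card_fin,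
      nsmul_eq_mul]
    push_cast
    rw [show (n : ℝ) + 2 + 2 = n + 4 by ring]
    congr 1
    ring
  have hsq : ∑ k, x k ^ 2 = (n + 2 : ℝ) := by
    have := sum_sq_sphere v
    push_cast at this
    exact this
  have hoff : ∀ q : Fin (n + 2) → Fin (n + 2) → ℝ,
      ∑ p ∈ (Finset.univ : Finset (Fin (n + 2))).offDiag, q p.1 p.2 =
        ∑ i, ∑ j, q i j - ∑ i, q i i := by
    intro q
    have := Finset.sum_union (Finset.disjoint_diag_offDiag (Finset.univ : Finset (Fin (n + 2))))
      (f := fun p => q p.1 p.2)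
    rw [Finset.diag_union_offDiag, Finset.sum_product, Finset.sum_diag] at this
    rw [this]
    ring
  rw [hoff fun i j => gapFunction (n + 2) v - 1 / 4 * (x i ^ 4 + x j ^ 4 -
    6 * (x i ^ 2 * x j ^ 2))] at h2
  have h5 : ∀ k, x k ^ 2 * x k ^ 2 = x k ^ 4 := fun k => by ring
  have h6 := eq_div_of_mul_eq (two_ne_zero) ((mul_comm _ _).trans h2)
  rw [Q, Finset.sum_congr rfl fun p _ => h1 p, cast_choose_two, h6]
  simp only [Finset.sum_sub_distrib, Finset.sum_add_distrib, ← Finset.mul_sum, Finset.sum_const,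
    Finset.card_univ, Fintype.card_fin, nsmul_eq_mul, hsq, h5, ← Finset.sum_mul, hG]
  push_cast
  field_simp
  ring

/-- By Euler's identity a homogeneous invariant `p` of degree `d` with `∂_i p = x_i q` satisfies `d
p = |x|² q = N q` on the sphere, and `q` is an invariant of smaller degree. -/
theorem exists_evalSphere_eq_const (hN : 2 ≤ N) {f : MvPolynomial (Fin N) ℝ}
    (hf : f ∈ rotInvariants (Finset.univ : Finset (Fin N))) :
    ∃ c : ℝ, ∀ v, evalSphere f v = c := by
  have hcard : 2 ≤ (Finset.univ : Finset (Fin N)).card := by simpa using hN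
  suffices H : ∀ n, ∀ f ∈ rotInvariants (Finset.univ : Finset (Fin N)), f.totalDegree < n →
      ∃ c : ℝ, ∀ v, evalSphere f v = c from H _ f hf (Nat.lt_succ_self _)
  intro n
  induction n with
  | zero => intro f _ h; omega
  | succ n ih =>
    intro f hf hn
    have hcomp : ∀ d ∈ Finset.range (f.totalDegree + 1),
        ∃ c : ℝ, ∀ v, evalSphere (homogeneousComponent d f) v = c := by
      intro d hd
      set p := homogeneousComponent d f
      have hp : p ∈ rotInvariants (Finset.univ : Finset (Fin N)) :=
        homogeneousComponent_mem_rotInvariants hf d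
      have hpd : p.IsHomogeneous d := homogeneousComponent_isHomogeneous d f
      rcases Nat.eq_zero_or_pos d with rfl | hd0
      · refine ⟨coeff 0 p, fun v => ?_⟩
        rw [totalDegree_eq_zero_iff_eq_C.mp (Nat.le_zero.mp hpd.totalDegree_le)]
        simp [evalSphere]
      obtain ⟨q, hq⟩ := exists_pderiv_eq_X_mul hcard hp
      obtain ⟨c, hc⟩ : ∃ c : ℝ, ∀ v, evalSphere q v = c := by
        by_cases hq0 : q = 0
        · exact ⟨0, fun v => by simp [hq0, evalSphere]⟩
        let i : Fin N := ⟨0, by omega⟩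
        refine ih q (rotInvariants_of_X_mul (Finset.card_pos.mp (by omega)) hp hq) ?_
        have h1 := hq i (Finset.mem_univ i)
        have h2 := totalDegree_pderiv_add_one_le i p (h1 ▸ mul_ne_zero (X_ne_zero i) hq0)
        rw [h1, totalDegree_mul_of_isDomain (X_ne_zero i) hq0, totalDegree_X] at h2
        have h3 := hpd.totalDegree_le
        rw [Finset.mem_range] at hd
        omega
      refine ⟨N * c / d, fun v => ?_⟩
      have h4 : (d : ℝ) * evalSphere p v = N * evalSphere q v := by
        have h5 := congrArg (fun g => evalSphere g v) hpd.sum_X_mul_pderiv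
        simp only [evalSphere, map_sum, map_mul, eval_X, map_nsmul] at h5
        have h6 : (N : ℝ) * evalSphere q v =
            ∑ k, (v : EuclideanSpace ℝ (Fin N)) k ^ 2 * evalSphere q v := by
          rw [← Finset.sum_mul, sum_sq_sphere]
        rw [evalSphere, ← nsmul_eq_mul, ← h5, h6]
        refine Finset.sum_congr rfl fun i hi => ?_
        rw [hq i hi, map_mul, eval_X, evalSphere]
        ring
      have : (d : ℝ) ≠ 0 := by positivity
      rw [eq_div_iff this, ← hc v, ← h4, mul_comm]
    choose! c hc using hcomp
    refine ⟨∑ d ∈ Finset.range (f.totalDegree + 1), c d, fun v => ?_⟩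
    conv_lhs => rw [← sum_homogeneousComponent f, evalSphere, map_sum]
    exact Finset.sum_congr rfl fun d hd => hc d hd v

end Collision

end Kac

namespace Kac

open scoped Pointwise

/-! ### Rotation invariance of the uniform measure -/

section Invariance

variable {N : ℕ}

theorem collideVec_collideVec_neg {i j : Fin N} (hij : i ≠ j) (θ : ℝ)
    (v : EuclideanSpace ℝ (Fin N)) : collideVec i j θ (collideVec i j (-θ) v) = v := by
  ext k
  have h := Real.sin_sq_add_cos_sq θ
  simp only [collideVec_apply, if_pos, if_neg hij.symm, Real.cos_neg, Real.sin_neg]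
  split_ifs with h1 h2
  · subst h1; linear_combination v k * h
  · subst h2; linear_combination v k * h
  · rfl

/-- The collision as a linear isometry of `ℝ^N`. -/
noncomputable def collideIsometry {i j : Fin N} (hij : i ≠ j) (θ : ℝ) :
    EuclideanSpace ℝ (Fin N) ≃ₗᵢ[ℝ] EuclideanSpace ℝ (Fin N) where
  toFun := collideVec i j θ
  invFun := collideVec i j (-θ)
  left_inv v := by simpa using collideVec_collideVec_neg hij (-θ) v
  right_inv v := collideVec_collideVec_neg hij θ v
  map_add' v w := by
    ext k
    simp only [collideVec_apply, PiLp.add_apply]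
    split_ifs <;> ring
  map_smul' r v := by
    ext k
    simp only [collideVec_apply, PiLp.smul_apply, smul_eq_mul, RingHom.id_apply]
    split_ifs <;> ring
  norm_map' v := norm_collideVec hij θ v

/-- The action of a linear isometry on the unit sphere. -/
def unitSphereMap {E : Type*} [NormedAddCommGroup E] [NormedSpace ℝ E] (e : E ≃ₗᵢ[ℝ] E)
    (x : Metric.sphere (0 : E) 1) : Metric.sphere (0 : E) 1 :=
  ⟨e x, by simp⟩

theorem measurePreserving_unitSphereMap {E : Type*} [NormedAddCommGroup E]
    [InnerProductSpace ℝ E] [FiniteDimensional ℝ E] [MeasurableSpace E] [BorelSpace E]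
    (e : E ≃ₗᵢ[ℝ] E) :
    MeasurePreserving (unitSphereMap e) (volume : Measure E).toSphere
      (volume : Measure E).toSphere := by
  have hm : Measurable (unitSphereMap e) :=
    (e.continuous.measurable.comp measurable_subtype_coe).subtype_mk
  refine ⟨hm, Measure.ext fun s hs => ?_⟩
  -- Surface measure is defined by the volume of cones over a set, which linear isometries preserve.
  have he : volume (e ⁻¹' (Set.Ioo (0 : ℝ) 1 • ((↑) '' s))) =
      volume (Set.Ioo (0 : ℝ) 1 • ((↑) '' s) : Set E) :=
    e.measurePreserving.measure_preimage_equiv (f := e.toHomeomorph.toMeasurableEquiv) _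
  rw [Measure.map_apply hm hs, Measure.toSphere_apply' _ hs, Measure.toSphere_apply' _ (hm hs),
    ← he]
  congr 2
  ext x
  simp only [Set.mem_smul, Set.mem_image, Set.mem_preimage]
  constructor
  · rintro ⟨r, hr, _, ⟨u, hu, rfl⟩, rfl⟩
    exact ⟨r, hr, _, ⟨_, hu, rfl⟩, (map_smul e r _).symm⟩
  · rintro ⟨r, hr, _, ⟨w, hw, rfl⟩, h⟩
    refine ⟨r, hr, e.symm w, ⟨unitSphereMap e.symm w, ?_, rfl⟩, ?_⟩
    · have : unitSphereMap e (unitSphereMap e.symm w) = w :=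
        Subtype.ext (e.apply_symm_apply _)
      rwa [this]
    · rw [← map_smul, h]
      exact e.symm_apply_apply x

theorem continuous_dilate (N : ℕ) : Continuous (dilate N) :=
  (continuous_subtype_val.const_smul (Real.sqrt N)).subtype_mk _

theorem continuous_collide {i j : Fin N} (hij : i ≠ j) :
    Continuous fun p : KacSphere N × ℝ => collide hij p.2 p.1 := by
  refine Continuous.subtype_mk ?_ _
  refine (PiLp.continuous_toLp 2 _).comp (continuous_pi fun k => ?_)
  have hv : ∀ k, Continuous fun p : KacSphere N × ℝ => (p.1 : EuclideanSpace ℝ (Fin N)) k :=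
    fun k => (EuclideanSpace.proj k).continuous.comp (continuous_subtype_val.comp continuous_fst)
  have hc := Real.continuous_cos.comp (continuous_snd (X := KacSphere N))
  have hs := Real.continuous_sin.comp (continuous_snd (X := KacSphere N))
  by_cases h1 : k = i
  · simp only [if_pos h1]
    exact (hc.mul (hv i)).sub (hs.mul (hv j))
  · by_cases h2 : k = j
    · simp only [if_neg h1, if_pos h2]
      exact (hs.mul (hv i)).add (hc.mul (hv j))
    · simp only [if_neg h1, if_neg h2]
      exact hv k

theorem continuous_collide_right {i j : Fin N} (hij : i ≠ j) (θ : ℝ) :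
    Continuous (collide (N := N) hij θ) := by
  have h : Continuous fun v : KacSphere N => (v, θ) := by fun_prop
  have h2 := (continuous_collide hij).comp h
  exact h2

/-- The collision as a homeomorphism of the sphere. -/
noncomputable def collideHomeomorph {i j : Fin N} (hij : i ≠ j) (θ : ℝ) : KacSphere N ≃ₜ KacSphere N where
  toFun := collide hij θ
  invFun := collide hij (-θ)
  left_inv v := by
    have h := collideVec_collideVec_neg hij (-θ) (v : EuclideanSpace ℝ (Fin N))
    rw [neg_neg] at h
    exact Subtype.ext h
  right_inv v := Subtype.ext (collideVec_collideVec_neg hij θ v)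
  continuous_toFun := continuous_collide_right hij θ
  continuous_invFun := continuous_collide_right hij (-θ)

theorem measurePreserving_collide {i j : Fin N} (hij : i ≠ j) (θ : ℝ) :
    MeasurePreserving (collide hij θ) (sigma N) (sigma N) := by
  have hm : Measurable (collide hij θ) := (collideHomeomorph hij θ).continuous.measurable
  refine ⟨hm, ?_⟩
  have hd := (continuous_dilate N).measurable
  have hU := measurePreserving_unitSphereMap (collideIsometry hij θ)
  have hcomm : collide hij θ ∘ dilate N =
      dilate N ∘ unitSphereMap (collideIsometry hij θ) := by
    funext x
    exact Subtype.ext ((collideIsometry hij θ).map_smul _ _)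
  rw [sigma, Measure.map_smul, Measure.map_map hm hd, hcomm, ← Measure.map_map hd hU.measurable,
    hU.map_eq]

instance sigma.instIsProbabilityMeasure (n : ℕ) : IsProbabilityMeasure (sigma (n + 2)) := by
  have h0 : (volume : Measure (EuclideanSpace ℝ (Fin (n + 2)))).toSphere Set.univ ≠ 0 := by
    rw [Ne, Measure.measure_univ_eq_zero]
    exact Measure.toSphere_ne_zero _
  refine ⟨?_⟩
  rw [sigma, Measure.smul_apply, Measure.map_apply (continuous_dilate _).measurable .univ,
    Set.preimage_univ, smul_eq_mul]
  exact ENNReal.inv_mul_cancel h0 (measure_ne_top _ _)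

theorem dilate_surjective (n : ℕ) : Function.Surjective (dilate (n + 2)) := by
  intro v
  have hpos : 0 < Real.sqrt ((n + 2 : ℕ) : ℝ) := Real.sqrt_pos.mpr (by positivity)
  refine ⟨⟨(Real.sqrt ((n + 2 : ℕ) : ℝ))⁻¹ • (v : EuclideanSpace ℝ (Fin (n + 2))), ?_⟩, ?_⟩
  · rw [mem_sphere_zero_iff_norm, norm_smul, mem_sphere_zero_iff_norm.mp v.2, norm_inv,
      Real.norm_of_nonneg hpos.le, inv_mul_cancel₀ hpos.ne']
  · refine Subtype.ext ?_
    exact smul_inv_smul₀ hpos.ne' _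

instance sigma.instIsOpenPosMeasure (n : ℕ) : (sigma (n + 2)).IsOpenPosMeasure := by
  refine ⟨fun U hU hne h0 => ?_⟩
  rw [sigma, Measure.smul_apply, smul_eq_mul, mul_eq_zero] at h0
  rcases h0 with h0 | h0
  · exact measure_ne_top _ _ (ENNReal.inv_eq_zero.mp h0)
  · rw [Measure.map_apply (continuous_dilate _).measurable hU.measurableSet] at h0
    refine (hU.preimage (continuous_dilate _)).measure_ne_zero _ ?_ h0
    exact hne.preimage (dilate_surjective n)

end Invariance

/-! ### The transition operator on square integrable functions -/

section PairAverage

variable {n : ℕ}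

/-- Lebesgue measure on the interval of scattering angles. -/
noncomputable def angleMeasure : Measure ℝ := volume.restrict (Set.Ioc (-Real.pi) Real.pi)

instance : IsFiniteMeasure angleMeasure := by
  rw [angleMeasure]; infer_instance

theorem integral_angleMeasure (h : ℝ → ℝ) :
    ∫ θ, h θ ∂angleMeasure = ∫ θ in (-Real.pi)..Real.pi, h θ := by
  rw [intervalIntegral.integral_of_le (by linarith [Real.pi_pos]), angleMeasure]

theorem pairAverage_eq {ρ : ℝ → ℝ} (hρ : ∀ θ, ρ θ = 1 / (2 * Real.pi)) {i j : Fin (n + 2)}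
    (hij : i ≠ j) (F : KacSphere (n + 2) → ℝ) (v : KacSphere (n + 2)) :
    pairAverage ρ hij F v = 1 / (2 * Real.pi) * ∫ θ, F (collide hij θ v) ∂angleMeasure := by
  rw [pairAverage, integral_angleMeasure, ← intervalIntegral.integral_const_mul]
  simp only [hρ]

theorem measurePreserving_collide_prod {i j : Fin (n + 2)} (hij : i ≠ j) :
    MeasurePreserving (fun p : KacSphere (n + 2) × ℝ => (collide hij p.2 p.1, p.2))
      ((sigma (n + 2)).prod angleMeasure) ((sigma (n + 2)).prod angleMeasure) := by
  have hc : Continuous (Function.uncurry fun (θ : ℝ) (v : KacSphere (n + 2)) => collide hij θ v) := by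
    have h := (continuous_collide hij).comp (continuous_swap (X := ℝ) (Y := KacSphere (n + 2)))
    exact h
  have h := (MeasurePreserving.id angleMeasure).skew_product (μc := sigma (n + 2))
    (μd := sigma (n + 2)) (g := fun θ v => collide hij θ v) hc.measurable
    (Filter.Eventually.of_forall fun θ => (measurePreserving_collide hij θ).map_eq)
  exact Measure.measurePreserving_swap.comp (h.comp Measure.measurePreserving_swap)

theorem memLp_collide {i j : Fin (n + 2)} (hij : i ≠ j) {F : KacSphere (n + 2) → ℝ}
    (hF : MemLp F 2 (sigma (n + 2))) :
    MemLp (fun p : KacSphere (n + 2) × ℝ => F (collide hij p.2 p.1)) 2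
      ((sigma (n + 2)).prod angleMeasure) :=
  (hF.comp_fst angleMeasure).comp_measurePreserving (measurePreserving_collide_prod hij)

theorem integrable_collide_ae {i j : Fin (n + 2)} (hij : i ≠ j) {F : KacSphere (n + 2) → ℝ}
    (hF : MemLp F 2 (sigma (n + 2))) :
    ∀ᵐ v ∂sigma (n + 2), Integrable (fun θ => F (collide hij θ v)) angleMeasure :=
  ((memLp_collide hij hF).integrable one_le_two).prod_right_ae

theorem sq_integral_le {α : Type*} [MeasurableSpace α] {μ : Measure α} [IsFiniteMeasure μ]
    {h : α → ℝ} (h1 : Integrable h μ) (h2 : Integrable (fun x => h x ^ 2) μ) :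
    (∫ x, h x ∂μ) ^ 2 ≤ μ.real Set.univ * ∫ x, h x ^ 2 ∂μ := by
  set a := ∫ x, h x ∂μ
  set m := μ.real Set.univ
  have hm : 0 ≤ m := measureReal_nonneg
  -- Cauchy–Schwarz as positivity of a variance; the scaling by `m` avoids dividing by a total mass
  -- that may be zero.
  have h3 : ∫ x, (m * h x - a) ^ 2 ∂μ = m * (m * ∫ x, h x ^ 2 ∂μ - a ^ 2) := by
    have : ∀ x, (m * h x - a) ^ 2 = m ^ 2 * h x ^ 2 - 2 * m * a * h x + a ^ 2 := fun x => by ring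
    simp only [this]
    have h5 : Integrable (fun x => m ^ 2 * h x ^ 2 - 2 * m * a * h x) μ :=
      (h2.const_mul _).sub (h1.const_mul _)
    rw [integral_add h5 (integrable_const _), integral_sub (h2.const_mul _) (h1.const_mul _), integral_const_mul, integral_const_mul,
      integral_const, smul_eq_mul]
    change m ^ 2 * _ - 2 * m * a * a + m * a ^ 2 = _
    ring
  have h4 : 0 ≤ ∫ x, (m * h x - a) ^ 2 ∂μ := integral_nonneg fun x => sq_nonneg _
  rcases hm.eq_or_lt with h0 | h0
  · have : μ = 0 := by
      rw [← Measure.measure_univ_eq_zero]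
      exact ((measureReal_eq_zero_iff (measure_ne_top _ _)).mp h0.symm)
    have ha : a = 0 := by simp [a, this]
    rw [ha, ← h0]
    simp
  · rw [h3] at h4
    have := nonneg_of_mul_nonneg_right h4 h0
    linarith

theorem memLp_pairAverage {ρ : ℝ → ℝ} (hρ : ∀ θ, ρ θ = 1 / (2 * Real.pi)) {i j : Fin (n + 2)}
    (hij : i ≠ j) {F : KacSphere (n + 2) → ℝ} (hF : MemLp F 2 (sigma (n + 2))) :
    MemLp (pairAverage ρ hij F) 2 (sigma (n + 2)) := by
  have h : pairAverage ρ hij F =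
      fun v => 1 / (2 * Real.pi) * ∫ θ, F (collide hij θ v) ∂angleMeasure :=
    funext (pairAverage_eq hρ hij F)
  rw [h]
  refine MemLp.const_mul ?_ _
  have hI := (memLp_collide hij hF).integrable one_le_two
  have hI2 := (memLp_collide hij hF).integrable_sq
  rw [memLp_two_iff_integrable_sq hI.integral_prod_left.aestronglyMeasurable]
  refine Integrable.mono' (hI2.integral_prod_left.const_mul (angleMeasure.real Set.univ))
    (hI.integral_prod_left.aestronglyMeasurable.pow 2) ?_
  filter_upwards [hI.prod_right_ae, hI2.prod_right_ae] with v h1 h2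
  rw [Real.norm_of_nonneg (sq_nonneg _)]
  exact sq_integral_le h1 h2

theorem pairAverage_congr_ae {ρ : ℝ → ℝ} (hρ : ∀ θ, ρ θ = 1 / (2 * Real.pi))
    {i j : Fin (n + 2)} (hij : i ≠ j) {F G : KacSphere (n + 2) → ℝ}
    (h : F =ᵐ[sigma (n + 2)] G) :
    pairAverage ρ hij F =ᵐ[sigma (n + 2)] pairAverage ρ hij G := by
  have h1 : ∀ᵐ p ∂(sigma (n + 2)).prod angleMeasure, F (p : KacSphere (n + 2) × ℝ).1 = G p.1 :=
    Measure.quasiMeasurePreserving_fst.ae h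
  have h2 := (measurePreserving_collide_prod hij).quasiMeasurePreserving.ae h1
  filter_upwards [Measure.ae_ae_of_ae_prod h2] with v hv
  rw [pairAverage_eq hρ, pairAverage_eq hρ, integral_congr_ae hv]

theorem pairAverage_add_ae {ρ : ℝ → ℝ} (hρ : ∀ θ, ρ θ = 1 / (2 * Real.pi))
    {i j : Fin (n + 2)} (hij : i ≠ j) {F G : KacSphere (n + 2) → ℝ}
    (hF : MemLp F 2 (sigma (n + 2))) (hG : MemLp G 2 (sigma (n + 2))) :
    pairAverage ρ hij (F + G) =ᵐ[sigma (n + 2)] pairAverage ρ hij F + pairAverage ρ hij G := by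
  filter_upwards [integrable_collide_ae hij hF, integrable_collide_ae hij hG] with v h1 h2
  rw [Pi.add_apply, pairAverage_eq hρ, pairAverage_eq hρ, pairAverage_eq hρ, ← mul_add,
    ← integral_add h1 h2]
  rfl

/-- Each rotation preserves the measure and is inverted by `-θ`, while the law of `θ` is even. -/
theorem innerL2_pairAverage {ρ : ℝ → ℝ} (hρ : ∀ θ, ρ θ = 1 / (2 * Real.pi))
    {i j : Fin (n + 2)} (hij : i ≠ j) {F G : KacSphere (n + 2) → ℝ}
    (hF : MemLp F 2 (sigma (n + 2))) (hG : MemLp G 2 (sigma (n + 2))) :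
    innerL2 (pairAverage ρ hij F) G = innerL2 F (pairAverage ρ hij G) := by
  have hI : ∀ {F G : KacSphere (n + 2) → ℝ}, MemLp F 2 (sigma (n + 2)) →
      MemLp G 2 (sigma (n + 2)) → ∫ v, F v * pairAverage ρ hij G v ∂sigma (n + 2) =
        1 / (2 * Real.pi) * ∫ θ in (-Real.pi)..Real.pi,
          ∫ v, F v * G (collide hij θ v) ∂sigma (n + 2) := by
    intro F G hF hG
    have hint := (hF.comp_fst angleMeasure).integrable_mul (memLp_collide hij hG)
    rw [← integral_angleMeasure, ← integral_integral_swap hint, ← integral_const_mul]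
    refine integral_congr_ae (Filter.Eventually.of_forall fun v => ?_)
    simp only
    rw [pairAverage_eq hρ, integral_const_mul]
    ring
  have hflip : ∀ θ, ∫ v, G v * F (collide hij θ v) ∂sigma (n + 2) =
      ∫ v, F v * G (collide hij (-θ) v) ∂sigma (n + 2) := by
    intro θ
    rw [← (measurePreserving_collide hij (-θ)).integral_comp
      (collideHomeomorph hij (-θ)).measurableEmbedding]
    refine integral_congr_ae (Filter.Eventually.of_forall fun v => ?_)
    have : collide hij θ (collide hij (-θ) v) = v :=
      Subtype.ext (collideVec_collideVec_neg hij θ v)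
    simp only [this, mul_comm]
  have h1 : innerL2 (pairAverage ρ hij F) G =
      ∫ v, G v * pairAverage ρ hij F v ∂sigma (n + 2) := by
    rw [innerL2]
    simp only [mul_comm]
  rw [h1, innerL2, hI hG hF, hI hF hG]
  simp only [hflip]
  rw [intervalIntegral.integral_comp_neg
    (fun θ => ∫ v, F v * G (collide hij θ v) ∂sigma (n + 2)), neg_neg]

theorem memLp_Q {ρ : ℝ → ℝ} (hρ : ∀ θ, ρ θ = 1 / (2 * Real.pi)) {F : KacSphere (n + 2) → ℝ}
    (hF : MemLp F 2 (sigma (n + 2))) : MemLp (Q ρ F) 2 (sigma (n + 2)) := by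
  have h : MemLp (fun v => ∑ p : {p : Fin (n + 2) × Fin (n + 2) // p.1 < p.2},
      pairAverage ρ (ne_of_lt p.2) F v) 2 (sigma (n + 2)) :=
    memLp_finsetSum _ fun p _ => memLp_pairAverage hρ (ne_of_lt p.2) hF
  exact h.const_mul (1 / (((n + 2).choose 2 : ℕ) : ℝ))

theorem Q_congr_ae {ρ : ℝ → ℝ} (hρ : ∀ θ, ρ θ = 1 / (2 * Real.pi))
    {F G : KacSphere (n + 2) → ℝ} (h : F =ᵐ[sigma (n + 2)] G) :
    Q ρ F =ᵐ[sigma (n + 2)] Q ρ G := by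
  have h1 : ∀ᵐ v ∂sigma (n + 2), ∀ p : {p : Fin (n + 2) × Fin (n + 2) // p.1 < p.2},
      pairAverage ρ (ne_of_lt p.2) F v = pairAverage ρ (ne_of_lt p.2) G v :=
    ae_all_iff.mpr fun p => pairAverage_congr_ae hρ (ne_of_lt p.2) h
  filter_upwards [h1] with v hv
  rw [Q, Q, Finset.sum_congr rfl fun p _ => hv p]

theorem Q_add_ae {ρ : ℝ → ℝ} (hρ : ∀ θ, ρ θ = 1 / (2 * Real.pi))
    {F G : KacSphere (n + 2) → ℝ} (hF : MemLp F 2 (sigma (n + 2)))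
    (hG : MemLp G 2 (sigma (n + 2))) :
    Q ρ (F + G) =ᵐ[sigma (n + 2)] Q ρ F + Q ρ G := by
  have h1 : ∀ᵐ v ∂sigma (n + 2), ∀ p : {p : Fin (n + 2) × Fin (n + 2) // p.1 < p.2},
      pairAverage ρ (ne_of_lt p.2) (F + G) v =
        (pairAverage ρ (ne_of_lt p.2) F + pairAverage ρ (ne_of_lt p.2) G) v :=
    ae_all_iff.mpr fun p => pairAverage_add_ae hρ (ne_of_lt p.2) hF hG
  filter_upwards [h1] with v hv
  rw [Pi.add_apply, Q, Q, Q, Finset.sum_congr rfl fun p _ => hv p, ← mul_add,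
    ← Finset.sum_add_distrib]
  rfl

theorem Q_smul (ρ : ℝ → ℝ) (r : ℝ) (F : KacSphere (n + 2) → ℝ) :
    Q ρ (r • F) = r • Q ρ F := by
  funext v
  have h : ∀ p : {p : Fin (n + 2) × Fin (n + 2) // p.1 < p.2},
      pairAverage ρ (ne_of_lt p.2) (r • F) v = r * pairAverage ρ (ne_of_lt p.2) F v := by
    intro p
    rw [pairAverage, pairAverage, ← intervalIntegral.integral_const_mul]
    simp only [Pi.smul_apply, smul_eq_mul]
    congr 1
    funext θ
    ring
  rw [Pi.smul_apply, smul_eq_mul, Q, Q, Finset.sum_congr rfl fun p _ => h p, ← Finset.mul_sum]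
  ring

theorem innerL2_Q {ρ : ℝ → ℝ} (hρ : ∀ θ, ρ θ = 1 / (2 * Real.pi))
    {F G : KacSphere (n + 2) → ℝ} (hF : MemLp F 2 (sigma (n + 2)))
    (hG : MemLp G 2 (sigma (n + 2))) : innerL2 (Q ρ F) G = innerL2 F (Q ρ G) := by
  have h1 : innerL2 (Q ρ F) G = 1 / (((n + 2).choose 2 : ℕ) : ℝ) *
      ∑ p : {p : Fin (n + 2) × Fin (n + 2) // p.1 < p.2},
        innerL2 (pairAverage ρ (ne_of_lt p.2) F) G := by
    have hI : ∀ p : {p : Fin (n + 2) × Fin (n + 2) // p.1 < p.2},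
        Integrable (fun v => pairAverage ρ (ne_of_lt p.2) F v * G v) (sigma (n + 2)) := fun p =>
      (memLp_pairAverage hρ (ne_of_lt p.2) hF).integrable_mul hG
    simp only [innerL2]
    rw [← integral_finsetSum _ fun p _ => hI p, ← integral_const_mul]
    congr 1
    funext v
    rw [Q, mul_assoc, Finset.sum_mul]
  have h2 : innerL2 F (Q ρ G) = 1 / (((n + 2).choose 2 : ℕ) : ℝ) *
      ∑ p : {p : Fin (n + 2) × Fin (n + 2) // p.1 < p.2},
        innerL2 F (pairAverage ρ (ne_of_lt p.2) G) := by
    have hI : ∀ p : {p : Fin (n + 2) × Fin (n + 2) // p.1 < p.2},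
        Integrable (fun v => F v * pairAverage ρ (ne_of_lt p.2) G v) (sigma (n + 2)) := fun p =>
      hF.integrable_mul (memLp_pairAverage hρ (ne_of_lt p.2) hG)
    simp only [innerL2]
    rw [← integral_finsetSum _ fun p _ => hI p, ← integral_const_mul]
    congr 1
    funext v
    rw [Q, mul_left_comm, Finset.mul_sum]
  rw [h1, h2, Finset.sum_congr rfl fun p _ => innerL2_pairAverage hρ (ne_of_lt p.2) hF hG]

end PairAverage

end Kac

namespace Kac

/-! ### Symmetric operators with a dense span of eigenvectors -/

section Abstract

variable {H : Type*} [NormedAddCommGroup H] [InnerProductSpace ℝ H]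

theorem inner_le_of_mem_iSup_eigenspace {T : H →ₗ[ℝ] H} (hT : T.IsSymmetric) {c : ℝ} {x : H}
    (hx : x ∈ ⨆ μ : {μ : ℝ // μ ≤ c}, Module.End.eigenspace T μ) :
    inner ℝ (T x) x ≤ c * inner ℝ x x := by
  obtain ⟨f, hf, rfl⟩ := (Submodule.mem_iSup_iff_exists_finsupp _ _).mp hx
  have horth := hT.orthogonalFamily_eigenspaces.comp
    (Subtype.val_injective (p := fun μ : ℝ => μ ≤ c))
  have h1 := horth.inner_sum (fun μ => ⟨f μ, hf μ⟩) (fun μ => ⟨f μ, hf μ⟩) f.support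
  have h2 := horth.inner_sum (fun μ => (μ : ℝ) • ⟨f μ, hf μ⟩) (fun μ => ⟨f μ, hf μ⟩) f.support
  have hTf : ∀ μ, T (f μ) = (μ : ℝ) • f μ := fun μ => Module.End.mem_eigenspace_iff.mp (hf μ)
  have h3 : T (f.sum fun _ y => y) = ∑ μ ∈ f.support, (μ : ℝ) • f μ := by
    rw [Finsupp.sum, map_sum]
    exact Finset.sum_congr rfl fun μ _ => hTf μ
  rw [h3, Finsupp.sum]
  refine le_of_eq_of_le h2 (le_of_le_of_eq ?_ (congrArg (c * ·) h1.symm))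
  rw [Finset.mul_sum]
  refine Finset.sum_le_sum fun μ _ => ?_
  rw [real_inner_smul_left]
  exact mul_le_mul_of_nonneg_right μ.2 real_inner_self_nonneg

variable [CompleteSpace H]

/-- Eigenspaces for distinct eigenvalues are orthogonal, so a vector orthogonal to `e` lies in the
closure of the sum of those for eigenvalues at most `c`, where the bound holds by continuity. -/
theorem inner_le_of_dense_eigenvectors {T : H →ₗ[ℝ] H} (hT : T.IsSymmetric) {c : ℝ} {e : H}
    (he : T e = e) (hc : c < 1) {E : Set H} (hE : (Submodule.span ℝ E).topologicalClosure = ⊤)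
    (hE' : ∀ u ∈ E, u ∈ Submodule.span ℝ {e} ∨ ∃ μ ≤ c, T u = μ • u) {x : H}
    (hx : inner ℝ x e = 0) : inner ℝ (T x) x ≤ c * inner ℝ x x := by
  set W := ⨆ μ : {μ : ℝ // μ ≤ c}, Module.End.eigenspace T μ with hW
  have heW : ∀ w ∈ W, inner ℝ w e = 0 := by
    intro w hw
    refine Submodule.iSup_induction _ (motive := fun w => inner ℝ w e = 0) hw ?_ ?_ ?_
    · intro μ w hw
      have h1 := hT w e
      rw [he, Module.End.mem_eigenspace_iff.mp hw, real_inner_smul_left] at h1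
      have h2 : ((μ : ℝ) - 1) * inner ℝ w e = 0 := by rw [sub_mul, h1]; ring
      exact (mul_eq_zero.mp h2).resolve_left (by have := μ.2; linarith)
    · exact inner_zero_left _
    · intro a b ha hb
      rw [inner_add_left, ha, hb, add_zero]
  have heW' : ∀ w ∈ W.topologicalClosure, inner ℝ w e = 0 := fun w hw =>
    closure_minimal (s := (W : Set H)) (t := {w | inner ℝ w e = 0}) heW
      (isClosed_eq (by fun_prop) continuous_const) hw
  have hxW : x ∈ W.topologicalClosure := by
    have : CompleteSpace W.topologicalClosure :=
      W.isClosed_topologicalClosure.completeSpace_coe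
    obtain ⟨y, hy, z, hz, rfl⟩ := W.topologicalClosure.exists_add_mem_mem_orthogonal x
    have hze : inner ℝ z e = 0 := by
      rw [inner_add_left, heW' y hy, zero_add] at hx
      exact hx
    have hzE : z ∈ (Submodule.span ℝ E)ᗮ := by
      rw [Submodule.mem_orthogonal']
      intro u hu
      refine Submodule.span_induction (p := fun u _ => inner ℝ z u = 0) ?_ (inner_zero_right _)
        (fun a b _ _ ha hb => by rw [inner_add_right, ha, hb, add_zero])
        (fun r a _ ha => by rw [real_inner_smul_right, ha, mul_zero]) hu
      intro u hu
      rcases hE' u hu with h | ⟨μ, hμ, h⟩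
      · obtain ⟨r, rfl⟩ := Submodule.mem_span_singleton.mp h
        rw [real_inner_smul_right, hze, mul_zero]
      · refine (Submodule.mem_orthogonal' _ _).mp hz u (W.le_topologicalClosure ?_)
        exact Submodule.mem_iSup_of_mem (⟨μ, hμ⟩ : {μ : ℝ // μ ≤ c})
          (Module.End.mem_eigenspace_iff.mpr h)
    rw [Submodule.topologicalClosure_eq_top_iff.mp hE, Submodule.mem_bot] at hzE
    rwa [hzE, add_zero]
  -- Hellinger–Toeplitz: a symmetric operator defined on the whole Hilbert space is bounded.
  have hTc := hT.continuous
  exact closure_minimal (s := (W : Set H)) (t := {x | inner ℝ (T x) x ≤ c * inner ℝ x x})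
    (fun w hw => inner_le_of_mem_iSup_eigenspace hT hw)
    (isClosed_le (by fun_prop) (by fun_prop)) hxW

/-- The component of `x` orthogonal to `g` is again an eigenvector for `c`, hence orthogonal to the
whole dense family. -/
theorem mem_span_of_dense_eigenvectors {T : H →ₗ[ℝ] H} (hT : T.IsSymmetric) {c : ℝ} {g : H}
    (hg : T g = c • g) {E : Set H} (hE : (Submodule.span ℝ E).topologicalClosure = ⊤)
    (hE' : ∀ u ∈ E, ∃ μ : ℝ, T u = μ • u ∧ (μ = c → u ∈ Submodule.span ℝ {g})) {x : H}
    (hx : T x = c • x) : x ∈ Submodule.span ℝ {g} := by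
  obtain ⟨y, hy, z, hz, rfl⟩ := (Submodule.span ℝ {g}).exists_add_mem_mem_orthogonal x
  have hTz : T z = c • z := by
    obtain ⟨r, rfl⟩ := Submodule.mem_span_singleton.mp hy
    rw [map_add, map_smul, hg, smul_add, smul_comm r c] at hx
    exact add_left_cancel hx
  have hzE : z ∈ (Submodule.span ℝ E)ᗮ := by
    rw [Submodule.mem_orthogonal']
    intro u hu
    refine Submodule.span_induction (p := fun u _ => inner ℝ z u = 0) ?_ (inner_zero_right _)
      (fun a b _ _ ha hb => by rw [inner_add_right, ha, hb, add_zero])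
      (fun r a _ ha => by rw [real_inner_smul_right, ha, mul_zero]) hu
    intro u hu
    obtain ⟨μ, hμ, h⟩ := hE' u hu
    by_cases hμc : μ = c
    · exact (Submodule.mem_orthogonal' _ _).mp hz u (h hμc)
    · have h1 := hT z u
      rw [hTz, hμ, real_inner_smul_left, real_inner_smul_right] at h1
      have h2 : (c - μ) * inner ℝ z u = 0 := by rw [sub_mul, h1, sub_self]
      exact (mul_eq_zero.mp h2).resolve_left (sub_ne_zero.mpr (Ne.symm hμc))
  rw [Submodule.topologicalClosure_eq_top_iff.mp hE, Submodule.mem_bot] at hzE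
  rwa [hzE, add_zero]

end Abstract

/-! ### Density of the eigenpolynomials -/

section Density

open MvPolynomial

variable {n : ℕ}

/-- The restriction of polynomials to the sphere, as continuous functions. -/
noncomputable def polyToContinuous (N : ℕ) : MvPolynomial (Fin N) ℝ →ₐ[ℝ] C(KacSphere N, ℝ) :=
  aeval fun k => ⟨fun v => (v : EuclideanSpace ℝ (Fin N)) k,
    (EuclideanSpace.proj k).continuous.comp continuous_subtype_val⟩

theorem polyToContinuous_apply {N : ℕ} (f : MvPolynomial (Fin N) ℝ) (v : KacSphere N) :
    polyToContinuous N f v = evalSphere f v := by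
  induction f using MvPolynomial.induction_on with
  | C a => simp [polyToContinuous, evalSphere, ← algebraMap_eq]
  | add p q hp hq => simp only [evalSphere, map_add, ContinuousMap.add_apply] at *; rw [hp, hq]
  | mul_X p k hp =>
    simp only [evalSphere, map_mul, ContinuousMap.mul_apply, eval_X] at *
    rw [hp]
    simp only [polyToContinuous, aeval_X]
    rfl

theorem dense_range_polyToContinuous (N : ℕ) :
    DenseRange (polyToContinuous N) := by
  have h := ContinuousMap.subalgebra_topologicalClosure_eq_top_of_separatesPoints
    (polyToContinuous N).range (by
      intro v w hvw
      have : ∃ k, (v : EuclideanSpace ℝ (Fin N)) k ≠ (w : EuclideanSpace ℝ (Fin N)) k := by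
        by_contra! hk
        exact hvw (Subtype.ext (PiLp.ext hk))
      obtain ⟨k, hk⟩ := this
      refine ⟨_, ⟨polyToContinuous N (X k), ⟨X k, rfl⟩, rfl⟩, ?_⟩
      simpa [polyToContinuous_apply, evalSphere] using hk)
  intro f
  have h1 : f ∈ (polyToContinuous N).range.topologicalClosure := h ▸ Algebra.mem_top
  exact h1

/-- The restriction of polynomials to the sphere, as square integrable functions. -/
noncomputable def polyToL2 (n : ℕ) :
    MvPolynomial (Fin (n + 2)) ℝ →ₗ[ℝ] Lp ℝ 2 (sigma (n + 2)) :=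
  (ContinuousMap.toLp 2 (sigma (n + 2)) ℝ).toLinearMap ∘ₗ (polyToContinuous (n + 2)).toLinearMap

theorem coeFn_polyToL2 (f : MvPolynomial (Fin (n + 2)) ℝ) :
    polyToL2 n f =ᵐ[sigma (n + 2)] evalSphere f := by
  have h := ContinuousMap.coeFn_toLp (p := 2) (𝕜 := ℝ) (sigma (n + 2)) (polyToContinuous (n + 2) f)
  filter_upwards [h] with v hv
  exact hv.trans (polyToContinuous_apply f v)

theorem denseRange_polyToL2 (n : ℕ) : DenseRange (polyToL2 n) := by
  have : SecondCountableTopology (KacSphere (n + 2)) := inferInstance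
  have : (sigma (n + 2)).WeaklyRegular :=
    Measure.WeaklyRegular.of_pseudoMetrizableSpace_secondCountable_of_locallyFinite _
  exact (ContinuousMap.toLp_denseRange (p := 2) ℝ (sigma (n + 2)) ℝ ENNReal.ofNat_ne_top).comp
    (dense_range_polyToContinuous (n + 2)) (ContinuousMap.toLp 2 (sigma (n + 2)) ℝ).continuous

/-- The restrictions to the sphere of the homogeneous eigenvectors of the pair averages. -/
def eigenPolys (n : ℕ) : Set (Lp ℝ 2 (sigma (n + 2))) :=
  {u | ∃ (d : ℕ) (f : HomPoly (Fin (n + 2)) d) (μ : ℝ), f ≠ 0 ∧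
    pairSum (Fin (n + 2)) d f = μ • f ∧ u = polyToL2 n (toPoly f)}

/-- In each degree the pair sum is symmetric on a finite-dimensional space, so its eigenvectors form
a basis there. -/
theorem polyToL2_mem_span (f : MvPolynomial (Fin (n + 2)) ℝ) :
    polyToL2 n f ∈ Submodule.span ℝ (eigenPolys n) := by
  rw [← sum_homogeneousComponent f, map_sum]
  refine sum_mem fun d _ => ?_
  obtain ⟨g, hg⟩ := exists_toPoly_eq (homogeneousComponent_isHomogeneous d f)
  have hT := pairSum_isSymmetric (σ := Fin (n + 2)) d
  let b := hT.eigenvectorBasis rfl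
  rw [← hg, ← b.sum_repr g, map_sum, map_sum]
  refine sum_mem fun i _ => ?_
  rw [map_smul, map_smul]
  exact Submodule.smul_mem _ _ (Submodule.subset_span
    ⟨d, b i, _, b.orthonormal.ne_zero i, hT.apply_eigenvectorBasis rfl i, rfl⟩)

theorem span_eigenPolys_closure (n : ℕ) :
    (Submodule.span ℝ (eigenPolys n)).topologicalClosure = ⊤ := by
  rw [← Submodule.dense_iff_topologicalClosure_eq_top]
  refine (denseRange_polyToL2 n).mono ?_
  rintro _ ⟨f, rfl⟩
  exact polyToL2_mem_span f

end Density

/-! ### The spectral gap and its eigenspace -/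

section Gap

open MvPolynomial

variable {n : ℕ} {ρ : ℝ → ℝ}

theorem inner_toLp {F G : KacSphere (n + 2) → ℝ} (hF : MemLp F 2 (sigma (n + 2)))
    (hG : MemLp G 2 (sigma (n + 2))) : inner ℝ (hF.toLp F) (hG.toLp G) = innerL2 F G := by
  rw [L2.inner_def, innerL2]
  refine integral_congr_ae ?_
  filter_upwards [hF.coeFn_toLp, hG.coeFn_toLp] with v h1 h2
  rw [h1, h2]
  exact mul_comm _ _

/-- The transition operator on `L²` of the sphere. -/
noncomputable def QL2 (hρ : ∀ θ, ρ θ = 1 / (2 * Real.pi)) :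
    Lp ℝ 2 (sigma (n + 2)) →ₗ[ℝ] Lp ℝ 2 (sigma (n + 2)) where
  toFun f := (memLp_Q hρ (Lp.memLp f)).toLp _
  map_add' f g := by
    rw [← MemLp.toLp_add]
    exact (MemLp.toLp_eq_toLp_iff _ _).mpr ((Q_congr_ae hρ (Lp.coeFn_add f g)).trans
      (Q_add_ae hρ (Lp.memLp f) (Lp.memLp g)))
  map_smul' r f := by
    rw [RingHom.id_apply, ← MemLp.toLp_const_smul]
    exact (MemLp.toLp_eq_toLp_iff _ _).mpr ((Q_congr_ae hρ (Lp.coeFn_smul r f)).trans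
      (Filter.EventuallyEq.of_eq (Q_smul ρ r f)))

theorem QL2_toLp (hρ : ∀ θ, ρ θ = 1 / (2 * Real.pi)) {F : KacSphere (n + 2) → ℝ}
    (hF : MemLp F 2 (sigma (n + 2))) : QL2 hρ (hF.toLp F) = (memLp_Q hρ hF).toLp (Q ρ F) :=
  (MemLp.toLp_eq_toLp_iff (memLp_Q hρ (Lp.memLp _)) _).mpr (Q_congr_ae hρ hF.coeFn_toLp)

theorem QL2_isSymmetric (hρ : ∀ θ, ρ θ = 1 / (2 * Real.pi)) :
    (QL2 (n := n) hρ).IsSymmetric := by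
  intro f g
  have h1 := QL2_toLp hρ (Lp.memLp f)
  have h2 := QL2_toLp hρ (Lp.memLp g)
  rw [Lp.toLp_coeFn] at h1 h2
  rw [h1, h2]
  conv_lhs => rw [← Lp.toLp_coeFn g (Lp.memLp g)]
  conv_rhs => rw [← Lp.toLp_coeFn f (Lp.memLp f)]
  rw [inner_toLp, inner_toLp, innerL2_Q hρ (Lp.memLp f) (Lp.memLp g)]

theorem polyToL2_eq_toLp {f : MvPolynomial (Fin (n + 2)) ℝ} {F : KacSphere (n + 2) → ℝ}
    (h : evalSphere f = F) (hF : MemLp F 2 (sigma (n + 2))) : polyToL2 n f = hF.toLp F := by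
  refine Lp.ext ((coeFn_polyToL2 f).trans ?_)
  rw [h]
  exact hF.coeFn_toLp.symm

theorem memLp_evalSphere (f : MvPolynomial (Fin (n + 2)) ℝ) :
    MemLp (evalSphere f) 2 (sigma (n + 2)) :=
  (memLp_congr_ae (coeFn_polyToL2 f)).mp (Lp.memLp _)

theorem QL2_polyToL2 (hρ : ∀ θ, ρ θ = 1 / (2 * Real.pi)) {f : MvPolynomial (Fin (n + 2)) ℝ}
    {κ : ℝ} (h : Q ρ (evalSphere f) = fun v => κ * evalSphere f v) :
    QL2 hρ (polyToL2 n f) = κ • polyToL2 n f := by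
  have hf := memLp_evalSphere f
  rw [polyToL2_eq_toLp rfl hf, QL2_toLp, ← MemLp.toLp_const_smul]
  exact (MemLp.toLp_eq_toLp_iff _ _).mpr (Filter.EventuallyEq.of_eq h)

theorem polyToL2_one_mem (c : ℝ) {f : MvPolynomial (Fin (n + 2)) ℝ}
    (h : ∀ v, evalSphere f v = c) : polyToL2 n f = c • polyToL2 n 1 := by
  rw [← map_smul, polyToL2_eq_toLp rfl (memLp_evalSphere f),
    polyToL2_eq_toLp rfl (memLp_evalSphere (c • 1))]
  congr 1
  funext v
  rw [h v]
  simp [evalSphere, smul_eval]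

theorem Q_one (hρ : ∀ θ, ρ θ = 1 / (2 * Real.pi)) :
    Q ρ (evalSphere (1 : MvPolynomial (Fin (n + 2)) ℝ)) =
      fun v => 1 * evalSphere (1 : MvPolynomial (Fin (n + 2)) ℝ) v := by
  funext v
  have h : ∀ p : {p : Fin (n + 2) × Fin (n + 2) // p.1 < p.2},
      pairAverage ρ (ne_of_lt p.2) (evalSphere 1) v = evalSphere 1 v := fun p => by
    have := pairAverage_evalSphere_add_rot hρ (ne_of_lt p.2) (f := 1)
      (Derivation.map_one_eq_zero _) 0 v
    rwa [map_zero, add_zero] at this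
  have h2 := two_mul_sum_lt (N := n + 2) (fun _ _ => (1 : ℝ)) fun _ _ => rfl
  have hoff : ((Finset.univ : Finset (Fin (n + 2))).offDiag.card : ℝ) = (n + 2) * (n + 1) := by
    rw [Finset.offDiag_card, Finset.card_univ, Fintype.card_fin, Nat.cast_sub (by nlinarith)]
    push_cast
    ring
  rw [Finset.sum_const, Finset.sum_const, nsmul_eq_mul, nsmul_eq_mul, hoff] at h2
  rw [Q, Finset.sum_congr rfl fun p _ => h p, Finset.sum_const, nsmul_eq_mul, cast_choose_two]
  have h3 : ((Finset.univ : Finset {p : Fin (n + 2) × Fin (n + 2) // p.1 < p.2}).card : ℝ) =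
      (n + 2) * (n + 1) / 2 := by linarith
  rw [h3]
  field_simp

/-- The second largest eigenvalue of the transition operator. -/
noncomputable def subTop (n : ℕ) : ℝ := 1 - (n + 4) / (2 * ((n + 2) * (n + 1)))

theorem subTop_lt_one (n : ℕ) : subTop n < 1 := by
  have : (0 : ℝ) < (n + 4) / (2 * ((n + 2) * (n + 1))) := by positivity
  rw [subTop]
  linarith

theorem eigenPolys_cases (hρ : ∀ θ, ρ θ = 1 / (2 * Real.pi)) {u : Lp ℝ 2 (sigma (n + 2))}
    (hu : u ∈ eigenPolys n) :
    u ∈ Submodule.span ℝ {polyToL2 n 1} ∨ ∃ κ ≤ subTop n, QL2 hρ u = κ • u ∧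
      (1 ≤ n → κ = subTop n → u ∈ Submodule.span ℝ {polyToL2 n (gapPoly (n + 2))}) := by
  obtain ⟨d, f, μ, hf, hμ, rfl⟩ := hu
  have hconst : ∀ p ∈ rotInvariants (Finset.univ : Finset (Fin (n + 2))),
      ∃ c : ℝ, ∀ v, evalSphere p v = c := fun p hp => exists_evalSphere_eq_const (by omega) hp
  have hQ := QL2_polyToL2 hρ (Q_evalSphere_eigenvector hρ hμ)
  rcases pairSum_eigenvector (Fintype.card_fin _) hf hμ with h | ⟨hle, heq⟩
  · left
    obtain ⟨c, hc⟩ := hconst _ h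
    rw [polyToL2_one_mem c hc]
    exact Submodule.smul_mem _ _ (Submodule.mem_span_singleton_self _)
  · right
    have hpos : (0 : ℝ) < (n + 2) * (n + 1) := by positivity
    have hsub : subTop n = ((n + 2) * (n + 1) - (n + 4) / 2) / ((n + 2) * (n + 1)) := by
      rw [subTop]
      field_simp
    refine ⟨_, ?_, hQ, fun hn hκ => ?_⟩
    · rw [hsub]
      exact (div_le_div_iff_of_pos_right hpos).mpr hle
    · rw [hsub, div_left_inj' hpos.ne'] at hκ
      obtain ⟨a, ha, b, hb, c, hc, habc⟩ := heq hn hκ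
      obtain ⟨a', ha'⟩ := hconst a ha
      obtain ⟨b', hb'⟩ := hconst b hb
      obtain ⟨c', hc'⟩ := hconst c hc
      obtain ⟨r, hr⟩ : ∃ r : ℝ, polyToL2 n (toPoly f) =
          a' • polyToL2 n (gapPoly (n + 2)) + r • polyToL2 n 1 := by
        -- On the sphere `a`, `b`, `c` are constants and `∑ x_j² = N`; the first term compensates
        -- the constant subtracted in `gapFunction`.
        refine ⟨a' * (3 * (n + 2) ^ 2 / (n + 4)) + b' * (n + 2) + (n + 2) * c', ?_⟩
        rw [← sub_eq_iff_eq_add', ← map_smul, ← map_sub]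
        refine polyToL2_one_mem _ fun v => ?_
        have hsq := sum_sq_sphere v
        push_cast at hsq
        have hva : eval (fun k => (v : EuclideanSpace ℝ (Fin (n + 2))) k) a = a' := ha' v
        have hvb : eval (fun k => (v : EuclideanSpace ℝ (Fin (n + 2))) k) b = b' := hb' v
        have hvc : eval (fun k => (v : EuclideanSpace ℝ (Fin (n + 2))) k) c = c' := hc' v
        have hvG : eval (fun k => (v : EuclideanSpace ℝ (Fin (n + 2))) k) (gapPoly (n + 2)) =
            gapFunction (n + 2) v := congrFun (evalSphere_gapPoly (n + 2)) v
        rw [habc, evalSphere, map_sub, smul_eval, hvG, map_sum]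
        simp only [map_add, map_mul, map_pow, eval_X, hva, hvb, hvc, gapFunction,
          Finset.sum_add_distrib, Finset.sum_sub_distrib, ← Finset.mul_sum, hsq, Finset.sum_const,
          Finset.card_univ, Fintype.card_fin, nsmul_eq_mul]
        push_cast
        field_simp
        ring
      have h1 : QL2 hρ (polyToL2 n 1) = (1 : ℝ) • polyToL2 n 1 := QL2_polyToL2 hρ (Q_one hρ)
      have hG : QL2 hρ (polyToL2 n (gapPoly (n + 2))) =
          subTop n • polyToL2 n (gapPoly (n + 2)) :=
        QL2_polyToL2 hρ (by rw [evalSphere_gapPoly]; exact Q_gapFunction hρ)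
      rw [hκ, ← hsub, hr, map_add, map_smul, map_smul, h1, hG] at hQ
      -- The quartic part and the whole both have eigenvalue `subTop n`, whereas constants have
      -- eigenvalue `1`; the constant part must vanish.
      have h2 : (1 - subTop n) • (r • polyToL2 n 1) = 0 := by
        rw [smul_add, smul_comm, add_right_inj] at hQ
        rw [sub_smul, ← hQ]
        module
      rw [smul_eq_zero_iff_right (by linarith [subTop_lt_one n])] at h2
      rw [hr, h2, add_zero]
      exact Submodule.smul_mem _ _ (Submodule.mem_span_singleton_self _)

theorem gapFunction_not_ae_zero (n : ℕ) :
    ¬ gapFunction (n + 2) =ᵐ[sigma (n + 2)] fun _ => 0 := by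
  intro h
  have hc : Continuous (gapFunction (n + 2)) := by
    have : gapFunction (n + 2) = polyToContinuous (n + 2) (gapPoly (n + 2)) := by
      funext v
      rw [polyToContinuous_apply, evalSphere_gapPoly]
    rw [this]
    exact ContinuousMap.continuous _
  have h0 := (hc.ae_eq_iff_eq _ continuous_const).mp h
  have hs : (0 : ℝ) ≤ ((n + 2 : ℕ) : ℝ) := Nat.cast_nonneg _
  -- At a pole, with all the energy in one particle, the value is `N²(N - 1)/(N + 2) ≠ 0`.
  let w : KacSphere (n + 2) := ⟨EuclideanSpace.single 0 (Real.sqrt ((n + 2 : ℕ) : ℝ)), by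
    rw [mem_sphere_zero_iff_norm, PiLp.norm_single, Real.norm_of_nonneg
      (Real.sqrt_nonneg _)]⟩
  have hw := congrFun h0 w
  have h4 : Real.sqrt ((n + 2 : ℕ) : ℝ) ^ 4 = ((n + 2 : ℕ) : ℝ) ^ 2 := by
    rw [show 4 = 2 * 2 from rfl, pow_mul, Real.sq_sqrt hs]
  have hsum : ∑ j, (w : EuclideanSpace ℝ (Fin (n + 2))) j ^ 4 = ((n + 2 : ℕ) : ℝ) ^ 2 := by
    rw [Finset.sum_eq_single 0]
    · simpa [w] using h4
    · intro j _ hj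
      simp [w, hj]
    · simp
  rw [gapFunction, Finset.sum_sub_distrib, hsum, Finset.sum_const, Finset.card_univ,
    Fintype.card_fin, nsmul_eq_mul] at hw
  push_cast at hw
  field_simp at hw
  have : (0 : ℝ) ≤ n := Nat.cast_nonneg n
  nlinarith

theorem innerL2_generator (hρ : ∀ θ, ρ θ = 1 / (2 * Real.pi)) {F : KacSphere (n + 2) → ℝ}
    (hF : MemLp F 2 (sigma (n + 2))) :
    innerL2 F (generator ρ F) = (n + 2) * (innerL2 F F - innerL2 F (Q ρ F)) := by
  have h1 : Integrable (fun v => F v * F v) (sigma (n + 2)) := hF.integrable_mul hF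
  have h2 : Integrable (fun v => F v * Q ρ F v) (sigma (n + 2)) :=
    hF.integrable_mul (memLp_Q hρ hF)
  simp only [innerL2]
  rw [← integral_sub h1 h2, ← integral_const_mul]
  congr 1
  funext v
  rw [generator]
  push_cast
  ring

theorem generator_gapFunction (hρ : ∀ θ, ρ θ = 1 / (2 * Real.pi)) (v : KacSphere (n + 2)) :
    generator ρ (gapFunction (n + 2)) v =
      (n + 2) * (1 - subTop n) * gapFunction (n + 2) v := by
  rw [generator, Q_gapFunction hρ, ← subTop]
  push_cast
  ring

theorem innerL2_Q_le (hρ : ∀ θ, ρ θ = 1 / (2 * Real.pi)) {F : KacSphere (n + 2) → ℝ}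
    (hF : MemLp F 2 (sigma (n + 2))) (h1 : innerL2 F (fun _ => 1) = 0) :
    innerL2 F (Q ρ F) ≤ subTop n * innerL2 F F := by
  have hone : evalSphere (1 : MvPolynomial (Fin (n + 2)) ℝ) = fun _ => 1 := by
    funext v
    simp [evalSphere]
  have hI : QL2 hρ (polyToL2 n 1) = polyToL2 n 1 := by
    rw [QL2_polyToL2 hρ (Q_one hρ), one_smul]
  have horth : inner ℝ (hF.toLp F) (polyToL2 n 1) = 0 := by
    rw [polyToL2_eq_toLp hone (hone ▸ memLp_evalSphere 1), inner_toLp, h1]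
  have h := inner_le_of_dense_eigenvectors (QL2_isSymmetric hρ) hI (subTop_lt_one n)
    (span_eigenPolys_closure n) (fun u hu => (eigenPolys_cases hρ hu).imp id
      fun ⟨κ, h1, h2, _⟩ => ⟨κ, h1, h2⟩) horth
  rwa [real_inner_comm, QL2_toLp, inner_toLp, inner_toLp] at h

theorem memLp_gapFunction (n : ℕ) : MemLp (gapFunction (n + 2)) 2 (sigma (n + 2)) :=
  evalSphere_gapPoly (n + 2) ▸ memLp_evalSphere _

/-- No moment is computed: `Q` is symmetric and the two functions have different eigenvalues. -/
theorem innerL2_gapFunction_one (hρ : ∀ θ, ρ θ = 1 / (2 * Real.pi)) :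
    innerL2 (gapFunction (n + 2)) (fun _ => 1) = 0 := by
  have hone : evalSphere (1 : MvPolynomial (Fin (n + 2)) ℝ) = fun _ => 1 := by
    funext v
    simp [evalSphere]
  have hm : MemLp (fun _ : KacSphere (n + 2) => (1 : ℝ)) 2 (sigma (n + 2)) :=
    hone ▸ memLp_evalSphere 1
  have h := innerL2_Q hρ (memLp_gapFunction n) hm
  have hQ1 := Q_one (n := n) hρ
  rw [hone] at hQ1
  have h2 : innerL2 (Q ρ (gapFunction (n + 2))) (fun _ => 1) =
      subTop n * innerL2 (gapFunction (n + 2)) (fun _ => 1) := by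
    rw [Q_gapFunction hρ, ← subTop, innerL2, innerL2, ← integral_const_mul]
    simp only [mul_assoc]
  rw [h2, hQ1] at h
  simp only [mul_one] at h
  have h3 : (1 - subTop n) * innerL2 (gapFunction (n + 2)) (fun _ => 1) = 0 := by
    rw [sub_mul, h, one_mul, sub_self]
  exact (mul_eq_zero.mp h3).resolve_left (by linarith [subTop_lt_one n])

/-- The infimum is a minimum, attained at the normalised `gapFunction`. -/
theorem gap_eq (hρ : ∀ θ, ρ θ = 1 / (2 * Real.pi)) :
    gap (n + 2) ρ = (n + 2) * (1 - subTop n) := by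
  refine IsLeast.csInf_eq ⟨?_, ?_⟩
  · set G := gapFunction (n + 2)
    have hG : MemLp G 2 (sigma (n + 2)) := memLp_gapFunction n
    have hpos : 0 < innerL2 G G := by
      rw [← inner_toLp hG hG, real_inner_self_eq_norm_sq]
      have : hG.toLp G ≠ 0 := fun h0 => gapFunction_not_ae_zero n
        (hG.coeFn_toLp.symm.trans (Lp.eq_zero_iff_ae_eq_zero.mp h0))
      positivity
    set r := (Real.sqrt (innerL2 G G))⁻¹ with hr
    have hr2 : r * r * innerL2 G G = 1 := by
      rw [hr, ← mul_inv, Real.mul_self_sqrt hpos.le, inv_mul_cancel₀ hpos.ne']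
    have hsmul : ∀ H : KacSphere (n + 2) → ℝ, innerL2 (r • G) H = r * innerL2 G H := by
      intro H
      rw [innerL2, innerL2, ← integral_const_mul]
      simp only [Pi.smul_apply, smul_eq_mul, mul_assoc]
    have hself : innerL2 (r • G) (r • G) = 1 := by
      have : innerL2 G (r • G) = r * innerL2 G G := by
        rw [innerL2, innerL2, ← integral_const_mul]
        simp only [Pi.smul_apply, smul_eq_mul, mul_left_comm]
      rw [hsmul, this, ← mul_assoc, hr2]
    refine ⟨r • G, hG.const_smul r, ?_, hself, ?_⟩
    · rw [hsmul, innerL2_gapFunction_one hρ, mul_zero]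
    · have h1 : innerL2 (r • G) (Q ρ (r • G)) = subTop n * innerL2 (r • G) (r • G) := by
        rw [Q_smul, Q_gapFunction hρ, ← subTop, innerL2, innerL2, ← integral_const_mul]
        congr 1
        funext v
        simp only [Pi.smul_apply, smul_eq_mul]
        ring
      rw [innerL2_generator hρ (hG.const_smul r), h1, hself, mul_one]
  · rintro _ ⟨F, hF, h1, h2, rfl⟩
    have h := innerL2_Q_le hρ hF h1
    rw [innerL2_generator hρ hF, h2]
    rw [h2, mul_one] at h
    have : (0 : ℝ) ≤ n + 2 := by positivity
    exact mul_le_mul_of_nonneg_left (by linarith) this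

theorem eq_smul_gapFunction (hρ : ∀ θ, ρ θ = 1 / (2 * Real.pi)) (hn : 1 ≤ n)
    {F : KacSphere (n + 2) → ℝ} (hF : MemLp F 2 (sigma (n + 2)))
    (h : generator ρ F =ᵐ[sigma (n + 2)] fun v => (n + 2) * (1 - subTop n) * F v) :
    ∃ c : ℝ, F =ᵐ[sigma (n + 2)] fun v => c * gapFunction (n + 2) v := by
  have hQ : Q ρ F =ᵐ[sigma (n + 2)] subTop n • F := by
    filter_upwards [h] with v hv
    rw [generator] at hv
    push_cast at hv
    have hpos : (n + 2 : ℝ) ≠ 0 := by positivity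
    rw [mul_assoc, mul_right_inj' hpos] at hv
    rw [Pi.smul_apply, smul_eq_mul]
    linarith
  have hT : QL2 hρ (hF.toLp F) = subTop n • hF.toLp F := by
    rw [QL2_toLp, ← MemLp.toLp_const_smul]
    exact (MemLp.toLp_eq_toLp_iff _ _).mpr hQ
  have hG : QL2 hρ (polyToL2 n (gapPoly (n + 2))) = subTop n • polyToL2 n (gapPoly (n + 2)) :=
    QL2_polyToL2 hρ (by rw [evalSphere_gapPoly]; exact Q_gapFunction hρ)
  have hmem := mem_span_of_dense_eigenvectors (QL2_isSymmetric hρ) hG (span_eigenPolys_closure n)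
    (fun u hu => by
      rcases eigenPolys_cases hρ hu with h1 | ⟨κ, _, h2, h3⟩
      · obtain ⟨r, rfl⟩ := Submodule.mem_span_singleton.mp h1
        refine ⟨1, ?_, fun h4 => absurd h4 (subTop_lt_one n).ne'⟩
        rw [map_smul, QL2_polyToL2 hρ (Q_one hρ), smul_comm]
      · exact ⟨κ, h2, h3 hn⟩) hT
  obtain ⟨c, hc⟩ := Submodule.mem_span_singleton.mp hmem
  refine ⟨c, ?_⟩
  rw [polyToL2_eq_toLp (evalSphere_gapPoly _) (memLp_gapFunction n), ← MemLp.toLp_const_smul,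
    MemLp.toLp_eq_toLp_iff] at hc
  exact hc.symm

end Gap

end Kac

theorem mainTheorem1 (N : ℕ) (hN : 2 ≤ N) (ρ : ℝ → ℝ)
    (hρ : ∀ θ : ℝ, ρ θ = 1 / (2 * Real.pi)) :
    Kac.gap N ρ = 1 / 2 * (((N : ℝ) + 2) / ((N : ℝ) - 1)) ∧
    Kac.IsEigenfunction ρ (Kac.gap N ρ) (Kac.gapFunction N) ∧
    (3 ≤ N → ∀ F : Kac.KacSphere N → ℝ, Kac.IsEigenfunction ρ (Kac.gap N ρ) F →
      ∃ c : ℝ, F =ᵐ[Kac.sigma N] fun v => c * Kac.gapFunction N v) := by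
  obtain ⟨n, rfl⟩ := Nat.exists_eq_add_of_le' hN
  have hgap := Kac.gap_eq (n := n) hρ
  refine ⟨?_, ⟨Kac.memLp_gapFunction n, Kac.gapFunction_not_ae_zero n, ?_⟩, ?_⟩
  · rw [hgap, Kac.subTop]
    push_cast
    rw [show (n : ℝ) + 2 - 1 = n + 1 by ring]
    field_simp
    ring
  · rw [hgap]
    exact Filter.Eventually.of_forall (Kac.generator_gapFunction hρ)
  · intro h3 F hF
    rw [hgap] at hF
    exact Kac.eq_smul_gapFunction hρ (by omega) hF.1 hF.2.2
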